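/- **Setting.** Let $B,N\ge 1$ be integers and let $\alpha>1$, $\beta>0$, $0<r_0<R<p$, $P_{\rm con}>0$ be constants. Transmitters $i=1,\dots,B$ sit at fixed points of the closed disc of radius $p-R$ about the origin of $\mathbb R^2$; users $k=1,\dots,K$ are i.i.d. uniform on the concentric disc of radius $p$. With $R_{i,k}$ the maximum of $r_0$ and the distance between transmitter $i$ and user $k$, put $\gamma_{i,k,n}=\beta^2R_{i,k}^{-2\alpha}|\nu_{i,k,n}|^2$ for $1\le n\le N$, where the $\nu_{i,k,n}\sim\mathcal{CN}(0,1)$ are i.i.d. and independent of the user locations (Rayleigh fading). Let $\mathcal P$ be the set of $(p_{i,n})$ with $p_{i,n}\ge0$ and $\sum_n p_{i,n}\le P_{\rm con}$ for every $i$, let $\mathcal U=\{1,\dots,K\}^{B\times N}$, and let $$\mathcal C^*_{\rm LB}=\max_{\vec p\in\mathcal P}\mathbb E\Big\{\max_{\vec u\in\mathcal U}\sum_{i=1}^B\sum_{n=1}^N\log\Big(1+\frac{\gamma_{i,u_{i,n},n}\,p_{i,n}}{1+\sum_{j\ne i}\gamma_{j,u_{i,n},n}\,p_{j,n}}\Big)\Big\}.$$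 For $c>0$ and $h>0$ let $$\mathsf{OP}(c,h)=\max_{\vec p\in\mathcal P}\sum_{i=1}^B\sum_{n=1}^N\log(1+p_{i,n}x_{i,n})\quad\text{s.t.}\quad \frac{r_0^2h}{p^2}=e^{x_{i,n}/(\beta^2r_0^{-2\alpha})}\prod_{j\ne i}\Big(1+\frac{p_{j,n}x_{i,n}}{c^{2\alpha}r_0^{-2\alpha}}\Big)\ \text{ for all } i,n,$$ where $(x_{i,n})$ ranges over the real solutions of the constraints with $1+p_{i,n}x_{i,n}>0$ for all $i,n$. For $\eta_1>0$ and $\eta_2\ge p^2/r_0^2$ let $\hat l(\eta_1,\eta_2)$ be the nonnegative solution $l$ of $$\frac{r_0^2\eta_2}{p^2}=e^{l/(\beta^2r_0^{-2\alpha})}\Big(1+\frac{l\,P_{\rm con}}{\eta_1^{2\alpha}r_0^{-2\alpha}}\Big)^{B-1}.$$ **Theorem.** 1. (Well-posedness.) For $K\ge1$ the expectations in $\mathcal C^*_{\rm LB}$ are finite and the maximum is attained. The maximum in $\mathsf{OP}(c,h)$ is attained for all $c,h>0$; if $h\ge p^2/r_0^2$, then for every $\vec p\in\mathcal P$ and all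 $i,n$ the constraint has exactly one solution $x_{i,n}\ge0$. For every $\eta_1>0$ and $\eta_2\ge p^2/r_0^2$ the number $\hat l(\eta_1,\eta_2)$ exists and is unique, and it is strictly increasing in $\eta_2$ and tends to $\infty$ as $\eta_2\to\infty$. 2. For all sufficiently large $K$ and all $S_1\in(0,K]$, $$(1-e^{-S_1})\,\mathsf{OP}(r_0,K/S_1)\le\mathcal C^*_{\rm LB}.$$ 3. Let $\bar l(2p,K)$ be any sequence in $K$ with $\bar l(2p,K)/\hat l(2p,K)\to1$ as $K\to\infty$; for instance $\bar l(2p,K)=\hat l(2p,K)$. Then for all sufficiently large $K$, $$\mathcal C^*_{\rm LB}\le\Big(1+\frac{\beta^2r_0^{-2\alpha}u}{\bar l(2p,K)}\Big)\mathsf{OP}(2p,K),$$ where $u$ is the Euler–Mascheroni constant. 4. For $0<c_1\le c_2$ and every $h>p^2/r_0^2$ (in particular $h=h(K)$ for an increasing unbounded function $h(\cdot)$ and large $K$), $\mathsf{OP}(c_1,h)>0$ and $$1\le\frac{\mathsf{OP}(c_2,h)}{\mathsf{OP}(c_1,h)}\le\Big(\frac{c_2}{c_1}\Big)^{2\alpha}.$$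 -/

import Mathlib

open MeasureTheory ProbabilityTheory Filter Set

noncomputable section

/-- The parameters of a downlink network with `B` transmitters: path-loss constants `α`, `β`,
truncation distance `r₀`, network radius `p`, the margin `R` by which the transmitters stay away
from the boundary, the power budget `Pcon` of every transmitter, and the transmitter locations. -/
structure Network (B : ℕ) where
  α : ℝ
  β : ℝ
  r₀ : ℝ
  R : ℝ
  p : ℝ
  Pcon : ℝ
  tx : Fin B → EuclideanSpace ℝ (Fin 2)
  one_lt_α : 1 < α
  β_pos : 0 < β
  r₀_pos : 0 < r₀
  r₀_lt_R : r₀ < R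
  R_lt_p : R < p
  Pcon_pos : 0 < Pcon
  tx_mem : ∀ i, tx i ∈ Metric.closedBall (0 : EuclideanSpace ℝ (Fin 2)) (p - R)

/-- The circularly symmetric complex Gaussian law `CN(0,1)`: independent real and imaginary parts,
each normal with mean `0` and variance `1/2`. -/
def complexGaussian : Measure ℂ :=
  ((gaussianReal 0 (1 / 2)).prod (gaussianReal 0 (1 / 2))).map
    (fun z : ℝ × ℝ => (z.1 : ℂ) + (z.2 : ℂ) * Complex.I)

/-- A realisation of all user locations and all fading factors `ν (i, k, n)`. -/
abbrev Sample (B N K : ℕ) : Type :=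
  (Fin K → EuclideanSpace ℝ (Fin 2)) × (Fin B × Fin K × Fin N → ℂ)

namespace Network

variable {B : ℕ} (net : Network B)

/-- The uniform distribution of a user on the disc of radius `p`. -/
def userLaw : Measure (EuclideanSpace ℝ (Fin 2)) :=
  ProbabilityTheory.cond volume (Metric.closedBall 0 net.p)

/-- The joint law: i.i.d. uniform user locations, independent of i.i.d. Rayleigh fading. -/
def law (N K : ℕ) : Measure (Sample B N K) :=
  (Measure.pi fun _ : Fin K => net.userLaw).prod
    (Measure.pi fun _ : Fin B × Fin K × Fin N => complexGaussian)

/-- The channel SNR `γ_{i,k,n} = β² R_{i,k}^{-2α} |ν_{i,k,n}|²`, where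
`R_{i,k} = max {r₀, distance of user k from transmitter i}`. -/
def snr {N K : ℕ} (ω : Sample B N K) (i : Fin B) (k : Fin K) (n : Fin N) : ℝ :=
  net.β ^ 2 * (max net.r₀ (dist (ω.1 k) (net.tx i))) ^ (-(2 * net.α)) * ‖ω.2 (i, k, n)‖ ^ 2

/-- The feasible power allocations. -/
def powerSet (N : ℕ) : Set (Fin B → Fin N → ℝ) :=
  {q | (∀ i n, 0 ≤ q i n) ∧ ∀ i, ∑ n, q i n ≤ net.Pcon}

/-- The sum-rate for powers `q` when transmitter `i` serves user `u i n` on resource block `n`. -/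
def sumRate {N K : ℕ} (q : Fin B → Fin N → ℝ) (ω : Sample B N K)
    (u : Fin B → Fin N → Fin K) : ℝ :=
  ∑ i, ∑ n, Real.log (1 + net.snr ω i (u i n) n * q i n /
    (1 + ∑ j ∈ Finset.univ.erase i, net.snr ω j (u i n) n * q j n))

/-- The sum-rate for powers `q`, maximised over the finitely many user allocations. -/
def maxRate {N K : ℕ} (q : Fin B → Fin N → ℝ) (ω : Sample B N K) : ℝ :=
  ⨆ u : Fin B → Fin N → Fin K, net.sumRate q ω u

/-- The expected sum-rate for a fixed power allocation. -/
def expRate (N K : ℕ) (q : Fin B → Fin N → ℝ) : ℝ :=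
  ∫ ω, net.maxRate q ω ∂(net.law N K)

/-- `C*_LB`: the maximum over power allocations of the expected sum-rate. -/
def CLB (N K : ℕ) : ℝ :=
  sSup (net.expRate N K '' net.powerSet N)

/-- The constraint that ties `x = x_{i,n}` to the powers `q`, with `h` the value of `h(K)`. -/
def Constraint {N : ℕ} (c h : ℝ) (q : Fin B → Fin N → ℝ) (i : Fin B) (n : Fin N) (x : ℝ) : Prop :=
  net.r₀ ^ 2 * h / net.p ^ 2 =
    Real.exp (x / (net.β ^ 2 * net.r₀ ^ (-(2 * net.α)))) *
      ∏ j ∈ Finset.univ.erase i,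
        (1 + q j n * x / (c ^ (2 * net.α) * net.r₀ ^ (-(2 * net.α))))

/-- The objective values of `OP(c, h)`: feasible powers `q` and numbers `x` that satisfy the
constraints and for which every logarithm in the objective is defined. A negative `x i n` only
contributes a nonpositive term. -/
def opValues (N : ℕ) (c h : ℝ) : Set ℝ :=
  {v | ∃ q ∈ net.powerSet N, ∃ x : Fin B → Fin N → ℝ,
    (∀ i n, net.Constraint c h q i n (x i n)) ∧ (∀ i n, 0 < 1 + q i n * x i n) ∧
    v = ∑ i, ∑ n, Real.log (1 + q i n * x i n)}

/-- The optimal value of the deterministic problem `OP(c, h)`. -/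
def OP (N : ℕ) (c h : ℝ) : ℝ :=
  sSup (net.opValues N c h)

/-- The equation that defines `l̂(η₁, η₂)`. -/
def LEquation (η₁ η₂ l : ℝ) : Prop :=
  net.r₀ ^ 2 * η₂ / net.p ^ 2 =
    Real.exp (l / (net.β ^ 2 * net.r₀ ^ (-(2 * net.α)))) *
      (1 + l * net.Pcon / (η₁ ^ (2 * net.α) * net.r₀ ^ (-(2 * net.α)))) ^ (B - 1)

/-- `l̂(η₁, η₂)`: the nonnegative solution of its equation, for `η₂ ≥ p² / r₀²` unique. -/
def lHat (η₁ η₂ : ℝ) : ℝ :=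
  sSup {l | 0 ≤ l ∧ net.LEquation η₁ η₂ l}

end Network

end

/-! Fix feasible powers `q`. For a user at a fixed location, the squared fading moduli are
independent exponentials of mean one, so the interference ratio `g_i|ν_i|² / (1 + ∑ g_j q_j |ν_j|²)`
exceeds `x` with probability exactly `1 / (e^{x/g_i} ∏ (1 + g_j q_j x / g_i))`: condition on the
interferers, then multiply their Laplace transforms (`pi_complexGaussian_sinr_ge`). The constraint
of `OP(c, h)` is therefore a quantile equation, with the gain `g_i` replaced by its largest value
and each ratio `g_j / g_i` replaced by `1 / pathRatio c`. The two values of `c` are extreme choices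
of that ratio.

Lower bound, `c = r₀`. A user lies within `r₀` of transmitter `i` with probability `r₀²/p²`. There
`g_i` is maximal and every ratio is at most one, so one user reaches the level `x` with probability
at least `1/h`. Some one of `K` users then does so with probability at least `1 - e^{-K/h}`, and `h
= K/S` gives the factor. Linearity of expectation handles the pairs `(i, n)` together, whatever
their dependence.

Upper bound, `c = 2p`. No user is farther than `2p` from a transmitter, so every ratio is at least
`1 / pathRatio (2p)`. The expected excess of one user over `x` is then at most a constant over `h`,
and with `h = K` all users together contribute `O(1)`. The slope of `s ↦ log (1 + w s)` beyond `x`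
is at most `1/x ≤ 1/l̂`, whence `C*_LB ≤ OP(2p, K) + C / l̂`. Since `OP(2p, K) → ∞`, this additive
error is absorbed into the factor `1 + const / l̄` for any positive constant; of the
Euler–Mascheroni constant only positivity matters.

Comparison in `c`. Enlarging `c` weakens the interference and raises the roots. Conversely, dividing
the powers by `ρ = (c₂/c₁)^{2α}` turns a solution for `c₂` into one for `c₁` with the same `x`, and
Bernoulli's inequality bounds the loss in the logarithms by the factor `ρ`. -/

noncomputable section

/-- The function `x ↦ e^{x/a} ∏_{j ∈ s} (1 + w_j x)`, which is the reciprocal of the tail of a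
signal-to-interference ratio under Rayleigh fading. -/
def expProd {ι : Type*} (a : ℝ) (s : Finset ι) (w : ι → ℝ) (x : ℝ) : ℝ :=
  Real.exp (x / a) * ∏ j ∈ s, (1 + w j * x)

/-! ### The reciprocal tail function: monotonicity and unique nonnegative roots. -/

section ExpProd

variable {ι : Type*} {a : ℝ} {s : Finset ι} {w : ι → ℝ} {x : ℝ}

theorem expProd_zero : expProd a s w 0 = 1 := by simp [expProd]

theorem continuous_expProd : Continuous (expProd a s w) := by
  unfold expProd
  fun_prop

theorem one_le_prod_one_add_mul (hw : ∀ j ∈ s, 0 ≤ w j) (hx : 0 ≤ x) :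
    1 ≤ ∏ j ∈ s, (1 + w j * x) := by
  calc (1 : ℝ) = ∏ _j ∈ s, 1 := by simp
    _ ≤ _ := Finset.prod_le_prod (fun _ _ => zero_le_one) fun j hj =>
         le_add_of_nonneg_right (mul_nonneg (hw j hj) hx)

theorem exp_le_expProd (hw : ∀ j ∈ s, 0 ≤ w j) (hx : 0 ≤ x) :
    Real.exp (x / a) ≤ expProd a s w x :=
  le_mul_of_one_le_right (Real.exp_pos _).le (one_le_prod_one_add_mul hw hx)

theorem expProd_pos (hw : ∀ j ∈ s, 0 ≤ w j) (hx : 0 ≤ x) : 0 < expProd a s w x :=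
  (Real.exp_pos _).trans_le (exp_le_expProd hw hx)

theorem expProd_le_expProd_weight {w' : ι → ℝ} (hw : ∀ j ∈ s, 0 ≤ w j)
    (hww' : ∀ j ∈ s, w j ≤ w' j) (hx : 0 ≤ x) : expProd a s w x ≤ expProd a s w' x := by
  refine mul_le_mul_of_nonneg_left (Finset.prod_le_prod (fun j hj => ?_) fun j hj => ?_)
    (Real.exp_pos _).le
  · have := mul_nonneg (hw j hj) hx
    positivity
  · gcongr
    exact hww' j hj

theorem strictMonoOn_expProd (ha : 0 < a) (hw : ∀ j ∈ s, 0 ≤ w j) :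
    StrictMonoOn (expProd a s w) (Ici 0) := by
  intro x hx y hy hxy
  have hx0 : (0 : ℝ) ≤ x := hx
  refine mul_lt_mul (Real.exp_lt_exp.2 (by gcongr))
    (Finset.prod_le_prod (fun j hj => ?_) fun j hj => ?_) ?_ (Real.exp_pos _).le
  · have := mul_nonneg (hw j hj) hx0
    positivity
  · have := hw j hj
    gcongr
  · exact zero_lt_one.trans_le (one_le_prod_one_add_mul hw hx0)

theorem existsUnique_expProd_eq (ha : 0 < a) (hw : ∀ j ∈ s, 0 ≤ w j) {y : ℝ} (hy : 1 ≤ y) :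
    ∃! x : ℝ, 0 ≤ x ∧ y = expProd a s w x := by
  have hy0 : 0 < y := zero_lt_one.trans_le hy
  have hlog : 0 ≤ a * Real.log y := mul_nonneg ha.le (Real.log_nonneg hy)
  -- At `a * Real.log y` the exponential factor alone already equals `y`, so the value there is at
  -- least `y`.
  have hmem : y ∈ Icc (expProd a s w 0) (expProd a s w (a * Real.log y)) := by
    refine ⟨by rwa [expProd_zero], le_trans ?_ (exp_le_expProd hw hlog)⟩
    rw [mul_div_cancel_left₀ _ ha.ne', Real.exp_log hy0]
  obtain ⟨x, hx, hxy⟩ := intermediate_value_Icc hlog continuous_expProd.continuousOn hmem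
  refine ⟨x, ⟨hx.1, hxy.symm⟩, fun z hz => ?_⟩
  exact (strictMonoOn_expProd ha hw).injOn hz.1 hx.1 (hz.2.symm.trans hxy.symm)

theorem le_of_expProd_eq (ha : 0 < a) (hw : ∀ j ∈ s, 0 ≤ w j) {y : ℝ} (hx : 0 ≤ x)
    (h : y = expProd a s w x) : x ≤ a * Real.log y := by
  have h1 := exp_le_expProd (a := a) hw hx
  rw [← h, ← Real.le_log_iff_exp_le ((Real.exp_pos _).trans_le h1), div_le_iff₀ ha] at h1
  linarith

end ExpProd

/-- Logarithm of Bernoulli's inequality `1 + ρ t ≤ (1 + t)^ρ`. -/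
theorem log_one_add_mul_le {t ρ : ℝ} (ht : 0 ≤ t) (hρ : 1 ≤ ρ) :
    Real.log (1 + ρ * t) ≤ ρ * Real.log (1 + t) := by
  rw [← Real.log_rpow (by linarith)]
  exact Real.log_le_log (by positivity) (one_add_mul_self_le_rpow_one_add (by linarith) hρ)

theorem log_one_add_add_le {s t : ℝ} (hs : 0 ≤ s) (ht : 0 ≤ t) :
    Real.log (1 + s + t) ≤ Real.log (1 + s) + t / (1 + s) := by
  have hs' : 0 < 1 + s := by linarith
  have : 1 + s + t = (1 + s) * (1 + t / (1 + s)) := by field_simp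
  have hd : 0 ≤ t / (1 + s) := by positivity
  rw [this, Real.log_mul hs'.ne' (by positivity)]
  have := Real.log_le_sub_one_of_pos (show 0 < 1 + t / (1 + s) by positivity)
  linarith

/-! ### The deterministic problem `OP` and its dependence on `c` and `h`. -/

namespace Network

variable {B : ℕ} (net : Network B) {N : ℕ}

theorem p_pos : 0 < net.p := net.r₀_pos.trans (net.r₀_lt_R.trans net.R_lt_p)

/-- The largest possible mean SNR `β² r₀^{-2α}`. -/
def maxGain : ℝ := net.β ^ 2 * net.r₀ ^ (-(2 * net.α))

theorem maxGain_pos : 0 < net.maxGain :=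
  mul_pos (pow_pos net.β_pos 2) (Real.rpow_pos_of_pos net.r₀_pos _)

/-- The normalisation `c^{2α} r₀^{-2α}` of the interference powers. -/
def pathRatio (c : ℝ) : ℝ := c ^ (2 * net.α) * net.r₀ ^ (-(2 * net.α))

theorem pathRatio_pos {c : ℝ} (hc : 0 < c) : 0 < net.pathRatio c :=
  mul_pos (Real.rpow_pos_of_pos hc _) (Real.rpow_pos_of_pos net.r₀_pos _)

theorem pathRatio_mono {c₁ c₂ : ℝ} (hc : 0 < c₁) (h : c₁ ≤ c₂) :
    net.pathRatio c₁ ≤ net.pathRatio c₂ :=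
  mul_le_mul_of_nonneg_right
    (Real.rpow_le_rpow hc.le h (by linarith [net.one_lt_α])) (Real.rpow_pos_of_pos net.r₀_pos _).le

theorem pathRatio_r₀ : net.pathRatio net.r₀ = 1 := by
  rw [pathRatio, ← Real.rpow_add net.r₀_pos, add_neg_cancel, Real.rpow_zero]

theorem pathRatio_eq_mul {c₁ c₂ : ℝ} (hc₁ : 0 < c₁) (hc₂ : 0 < c₂) :
    net.pathRatio c₂ = (c₂ / c₁) ^ (2 * net.α) * net.pathRatio c₁ := by
  have := Real.rpow_pos_of_pos hc₁ (2 * net.α)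
  rw [pathRatio, pathRatio, Real.div_rpow hc₂.le hc₁.le]
  field_simp

theorem constraint_iff {c h : ℝ} {q : Fin B → Fin N → ℝ} {i : Fin B} {n : Fin N} {x : ℝ} :
    net.Constraint c h q i n x ↔ net.r₀ ^ 2 * h / net.p ^ 2 =
      expProd net.maxGain (Finset.univ.erase i) (fun j => q j n / net.pathRatio c) x := by
  simp only [Constraint, expProd, maxGain, pathRatio, div_mul_eq_mul_div]

theorem lEquation_iff {c h l : ℝ} :
    net.LEquation c h l ↔ net.r₀ ^ 2 * h / net.p ^ 2 =
      expProd net.maxGain (Finset.range (B - 1)) (fun _ => net.Pcon / net.pathRatio c) l := by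
  simp only [LEquation, expProd, maxGain, pathRatio, div_mul_eq_mul_div, Finset.prod_const,
    Finset.card_range, mul_comm net.Pcon]

theorem one_le_iff {h : ℝ} :
    1 ≤ net.r₀ ^ 2 * h / net.p ^ 2 ↔ net.p ^ 2 / net.r₀ ^ 2 ≤ h := by
  have h1 : 0 < net.r₀ ^ 2 := pow_pos net.r₀_pos 2
  have h2 : 0 < net.p ^ 2 := pow_pos net.p_pos 2
  rw [one_le_div h2, div_le_iff₀ h1, mul_comm h]

theorem one_lt_iff {h : ℝ} :
    1 < net.r₀ ^ 2 * h / net.p ^ 2 ↔ net.p ^ 2 / net.r₀ ^ 2 < h := by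
  have h1 : 0 < net.r₀ ^ 2 := pow_pos net.r₀_pos 2
  have h2 : 0 < net.p ^ 2 := pow_pos net.p_pos 2
  rw [one_lt_div h2, div_lt_iff₀ h1, mul_comm h]

section PowerSet

variable {net} {q : Fin B → Fin N → ℝ}

theorem le_Pcon_of_mem_powerSet (hq : q ∈ net.powerSet N) (i : Fin B) (n : Fin N) :
    q i n ≤ net.Pcon :=
  (Finset.single_le_sum (fun m _ => hq.1 i m) (Finset.mem_univ n)).trans (hq.2 i)

end PowerSet

theorem zero_mem_powerSet : (0 : Fin B → Fin N → ℝ) ∈ net.powerSet N :=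
  ⟨fun _ _ => le_rfl, fun _ => by simpa using net.Pcon_pos.le⟩

theorem isCompact_powerSet : IsCompact (net.powerSet N) := by
  have hsub : net.powerSet N ⊆
      Set.pi univ fun _ : Fin B => Set.pi univ fun _ : Fin N => Icc 0 net.Pcon :=
    fun q hq i _ n _ => ⟨hq.1 i n, le_Pcon_of_mem_powerSet hq i n⟩
  refine IsCompact.of_isClosed_subset
    (isCompact_univ_pi fun _ => isCompact_univ_pi fun _ => isCompact_Icc) ?_ hsub
  simp only [powerSet, ofPred_and, ofPred_forall]
  exact (isClosed_iInter fun i => isClosed_iInter fun n =>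
    isClosed_le continuous_const (by fun_prop)).inter
    (isClosed_iInter fun i => isClosed_le (by fun_prop) continuous_const)

theorem weight_nonneg {c : ℝ} (hc : 0 < c) {q : Fin B → Fin N → ℝ} (hq : q ∈ net.powerSet N)
    (j : Fin B) (n : Fin N) : 0 ≤ q j n / net.pathRatio c :=
  div_nonneg (hq.1 j n) (net.pathRatio_pos hc).le

theorem existsUnique_constraint {c h : ℝ} (hc : 0 < c) (hh : net.p ^ 2 / net.r₀ ^ 2 ≤ h)
    {q : Fin B → Fin N → ℝ} (hq : q ∈ net.powerSet N) (i : Fin B) (n : Fin N) :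
    ∃! x : ℝ, 0 ≤ x ∧ net.Constraint c h q i n x := by
  simp only [constraint_iff]
  exact existsUnique_expProd_eq net.maxGain_pos (fun j _ => net.weight_nonneg hc hq j n)
    (net.one_le_iff.2 hh)

theorem constraint_mono {c₁ c₂ h x₁ x₂ : ℝ} (hc : 0 < c₁) (hcc : c₁ ≤ c₂)
    {q : Fin B → Fin N → ℝ} (hq : q ∈ net.powerSet N)
    {i : Fin B} {n : Fin N} (hx₁ : 0 ≤ x₁) (hx₂ : 0 ≤ x₂)
    (h1 : net.Constraint c₁ h q i n x₁) (h2 : net.Constraint c₂ h q i n x₂) : x₁ ≤ x₂ := by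
  rw [constraint_iff] at h1 h2
  have hw : ∀ j ∈ Finset.univ.erase i, 0 ≤ q j n / net.pathRatio c₂ :=
    fun j _ => net.weight_nonneg (hc.trans_le hcc) hq j n
  refine ((strictMonoOn_expProd net.maxGain_pos hw).le_iff_le (s := Ici 0) hx₁ hx₂).1 ?_
  rw [← h2, h1]
  exact expProd_le_expProd_weight hw (fun j _ => div_le_div_of_nonneg_left (hq.1 j n)
    (net.pathRatio_pos hc) (net.pathRatio_mono hc hcc)) hx₁

theorem exists_solution {c h : ℝ} (hc : 0 < c) (hh : net.p ^ 2 / net.r₀ ^ 2 ≤ h)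
    {q : Fin B → Fin N → ℝ} (hq : q ∈ net.powerSet N) :
    ∃ x : Fin B → Fin N → ℝ, (∀ i n, 0 ≤ x i n) ∧ ∀ i n, net.Constraint c h q i n (x i n) := by
  choose x hx using fun i n => (net.existsUnique_constraint hc hh hq i n).exists
  exact ⟨x, fun i n => (hx i n).1, fun i n => (hx i n).2⟩

/-- The objective of `OP`. -/
def opObj (q x : Fin B → Fin N → ℝ) : ℝ := ∑ i, ∑ n, Real.log (1 + q i n * x i n)

theorem opValue_mem {c h : ℝ} {q x : Fin B → Fin N → ℝ} (hq : q ∈ net.powerSet N)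
    (hx : ∀ i n, 0 ≤ x i n) (hqx : ∀ i n, net.Constraint c h q i n (x i n)) :
    opObj q x ∈ net.opValues N c h :=
  ⟨q, hq, x, hqx, fun i n => by have := mul_nonneg (hq.1 i n) (hx i n); linarith, rfl⟩

/-- The pairs of feasible powers and nonnegative roots form a compact set, so the objective has a
maximum there. The constraint may also have negative roots, but replacing one by the nonnegative
root can only raise its logarithm. -/
theorem exists_isGreatest_opValues {c h : ℝ} (hc : 0 < c) (hh : net.p ^ 2 / net.r₀ ^ 2 ≤ h) :
    ∃ q ∈ net.powerSet N, ∃ x : Fin B → Fin N → ℝ, (∀ i n, 0 ≤ x i n) ∧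
      (∀ i n, net.Constraint c h q i n (x i n)) ∧ IsGreatest (net.opValues N c h) (opObj q x) := by
  set y := net.r₀ ^ 2 * h / net.p ^ 2
  -- The upper end of the box is the bound of `le_of_expProd_eq` on a nonnegative root.
  let S : Set ((Fin B → Fin N → ℝ) × (Fin B → Fin N → ℝ)) :=
    (net.powerSet N ×ˢ (Set.pi univ fun _ => Set.pi univ fun _ => Icc 0 (net.maxGain * Real.log y)))
      ∩ {z | ∀ i n, net.Constraint c h z.1 i n (z.2 i n)}
  have hScl : IsClosed {z : (Fin B → Fin N → ℝ) × (Fin B → Fin N → ℝ) |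
      ∀ i n, net.Constraint c h z.1 i n (z.2 i n)} := by
    simp only [ofPred_forall]
    refine isClosed_iInter fun i => isClosed_iInter fun n => ?_
    simp only [Constraint]
    exact isClosed_eq continuous_const (by fun_prop)
  have hS : IsCompact S := (net.isCompact_powerSet.prod
    (isCompact_univ_pi fun _ => isCompact_univ_pi fun _ => isCompact_Icc)).inter_right hScl
  have hmem : ∀ q ∈ net.powerSet N, ∀ x : Fin B → Fin N → ℝ, (∀ i n, 0 ≤ x i n) →
      (∀ i n, net.Constraint c h q i n (x i n)) → (q, x) ∈ S := fun q hq x hx hqx =>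
    ⟨⟨hq, fun i _ n _ => ⟨hx i n, le_of_expProd_eq net.maxGain_pos
      (fun j _ => net.weight_nonneg hc hq j n) (hx i n) (net.constraint_iff.1 (hqx i n))⟩⟩, hqx⟩
  obtain ⟨x0, hx0, hqx0⟩ :=
    net.exists_solution hc hh (net.zero_mem_powerSet (N := N))
  have hcont : ContinuousOn (fun z : (Fin B → Fin N → ℝ) × (Fin B → Fin N → ℝ) =>
      opObj z.1 z.2) S := by
    unfold opObj
    refine continuousOn_finsetSum _ fun i _ => continuousOn_finsetSum _ fun n _ => ?_
    refine ContinuousOn.log (by fun_prop) fun z hz => ?_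
    have := mul_nonneg (hz.1.1.1 i n) (hz.1.2 i trivial n trivial).1
    positivity
  obtain ⟨⟨q, x⟩, hqx, hmax⟩ :=
    hS.exists_isMaxOn ⟨_, hmem 0 net.zero_mem_powerSet x0 hx0 hqx0⟩ hcont
  have hx : ∀ i n, 0 ≤ x i n := fun i n => (hqx.1.2 i trivial n trivial).1
  refine ⟨q, hqx.1.1, x, hx, hqx.2, net.opValue_mem hqx.1.1 hx hqx.2, ?_⟩
  rintro v ⟨q', hq', x', hqx', hpos, rfl⟩
  obtain ⟨x'', hx'', hqx''⟩ := net.exists_solution hc hh hq'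
  refine le_trans ?_ (hmax (hmem q' hq' x'' hx'' hqx''))
  refine Finset.sum_le_sum fun i _ => Finset.sum_le_sum fun n _ =>
    Real.log_le_log (hpos i n) ?_
  have h0 := hq'.1 i n
  rcases le_total 0 (x' i n) with h1 | h1
  · rw [(net.existsUnique_constraint hc hh hq' i n).unique ⟨h1, hqx' i n⟩ ⟨hx'' i n, hqx'' i n⟩]
  · have := hx'' i n
    gcongr
    linarith

/-- Below the threshold the left side of the constraint is less than one, while the right side is at
least one for `x ≥ 0`. All roots are thus negative, no term of the objective is positive, and zero
powers attain the value zero. -/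
theorem isGreatest_opValues_zero {c h : ℝ} (hc : 0 < c) (hh0 : 0 < h)
    (hh : h < net.p ^ 2 / net.r₀ ^ 2) : IsGreatest (net.opValues N c h) 0 := by
  have hp : 0 < net.r₀ ^ 2 * h / net.p ^ 2 :=
    div_pos (mul_pos (pow_pos net.r₀_pos 2) hh0) (pow_pos net.p_pos 2)
  constructor
  · refine ⟨0, net.zero_mem_powerSet,
      fun _ _ => net.maxGain * Real.log (net.r₀ ^ 2 * h / net.p ^ 2), fun i n => ?_, by simp, by simp⟩
    rw [constraint_iff, expProd, mul_div_cancel_left₀ _ net.maxGain_pos.ne', Real.exp_log hp]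
    simp
  · rintro v ⟨q, hq, x, hqx, hpos, rfl⟩
    refine Finset.sum_nonpos fun i _ => Finset.sum_nonpos fun n _ =>
      Real.log_nonpos (hpos i n).le ?_
    have hx : x i n ≤ 0 := by
      by_contra! hx
      have h1 := exp_le_expProd (a := net.maxGain) (s := Finset.univ.erase i)
        (fun j _ => net.weight_nonneg hc hq j n) hx.le
      rw [← net.constraint_iff.1 (hqx i n)] at h1
      have h2 := Real.one_le_exp (div_nonneg hx.le net.maxGain_pos.le)
      exact hh.not_ge (net.one_le_iff.1 (h2.trans h1))
    linarith [mul_nonpos_of_nonneg_of_nonpos (hq.1 i n) hx]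

theorem isGreatest_OP {c h : ℝ} (hc : 0 < c) (hh0 : 0 < h) :
    IsGreatest (net.opValues N c h) (net.OP N c h) := by
  rcases le_or_gt (net.p ^ 2 / net.r₀ ^ 2) h with hh | hh
  · obtain ⟨q, -, x, -, -, hg⟩ := net.exists_isGreatest_opValues (N := N) hc hh
    rwa [OP, hg.csSup_eq]
  · have hg := net.isGreatest_opValues_zero (N := N) hc hh0 hh
    rwa [OP, hg.csSup_eq]

theorem OP_eq_zero {c h : ℝ} (hc : 0 < c) (hh0 : 0 < h) (hh : h < net.p ^ 2 / net.r₀ ^ 2) :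
    net.OP N c h = 0 :=
  (net.isGreatest_opValues_zero hc hh0 hh).csSup_eq

theorem exists_OP_eq {c h : ℝ} (hc : 0 < c) (hh : net.p ^ 2 / net.r₀ ^ 2 ≤ h) :
    ∃ q ∈ net.powerSet N, ∃ x : Fin B → Fin N → ℝ, (∀ i n, 0 ≤ x i n) ∧
      (∀ i n, net.Constraint c h q i n (x i n)) ∧ net.OP N c h = opObj q x := by
  obtain ⟨q, hq, x, hx, hqx, hg⟩ := net.exists_isGreatest_opValues (N := N) hc hh
  exact ⟨q, hq, x, hx, hqx, hg.csSup_eq⟩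

theorem threshold_pos : 0 < net.p ^ 2 / net.r₀ ^ 2 :=
  div_pos (pow_pos net.p_pos 2) (pow_pos net.r₀_pos 2)

theorem opObj_le_OP {c h : ℝ} (hc : 0 < c) (hh : 0 < h)
    {q x : Fin B → Fin N → ℝ} (hq : q ∈ net.powerSet N)
    (hx : ∀ i n, 0 ≤ x i n) (hqx : ∀ i n, net.Constraint c h q i n (x i n)) :
    opObj q x ≤ net.OP N c h :=
  (net.isGreatest_OP hc hh).2 (net.opValue_mem hq hx hqx)

/-- All the power of transmitter `i₀` on resource block `n₀`, and no other power. -/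
def singlePower (i₀ : Fin B) (n₀ : Fin N) : Fin B → Fin N → ℝ :=
  Pi.single i₀ (Pi.single n₀ net.Pcon)

theorem singlePower_mem (i₀ : Fin B) (n₀ : Fin N) : net.singlePower i₀ n₀ ∈ net.powerSet N := by
  constructor
  · intro i n
    have h1 : (0 : Fin N → ℝ) ≤ Pi.single n₀ net.Pcon := Pi.single_nonneg.2 net.Pcon_pos.le
    exact (Pi.single_nonneg (i := i₀).2 h1 :
      (0 : Fin B → Fin N → ℝ) ≤ Pi.single i₀ (Pi.single n₀ net.Pcon)) i n
  · intro i
    rcases eq_or_ne i i₀ with rfl | h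
    · simp [singlePower]
    · simpa [singlePower, h] using net.Pcon_pos.le

/-- With a single active transmitter and resource block there is no interference in the constraint,
so `x` is explicit. This gives both the positivity of `OP` and its divergence, of order at least
`log log h`. -/
theorem log_le_OP (i₀ : Fin B) (n₀ : Fin N) {c h : ℝ} (hc : 0 < c)
    (hh : net.p ^ 2 / net.r₀ ^ 2 ≤ h) :
    Real.log (1 + net.Pcon * (net.maxGain * Real.log (net.r₀ ^ 2 * h / net.p ^ 2))) ≤
      net.OP N c h := by
  have hq := net.singlePower_mem i₀ n₀
  obtain ⟨x, hx, hqx⟩ := net.exists_solution hc hh hq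
  refine le_trans ?_ (net.opObj_le_OP hc (net.threshold_pos.trans_le hh) hq hx hqx)
  have hx₀ : x i₀ n₀ = net.maxGain * Real.log (net.r₀ ^ 2 * h / net.p ^ 2) := by
    have h1 := net.constraint_iff.1 (hqx i₀ n₀)
    have h2 : ∏ j ∈ Finset.univ.erase i₀,
        (1 + net.singlePower i₀ n₀ j n₀ / net.pathRatio c * x i₀ n₀) = 1 := by
      refine Finset.prod_eq_one fun j hj => ?_
      simp [singlePower, Finset.ne_of_mem_erase hj]
    rw [expProd, h2, mul_one] at h1
    rw [h1, Real.log_exp, mul_div_cancel₀ _ net.maxGain_pos.ne']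
  have hterm : ∀ i n, 0 ≤ Real.log (1 + net.singlePower i₀ n₀ i n * x i n) := fun i n =>
    Real.log_nonneg (by have := mul_nonneg (hq.1 i n) (hx i n); linarith)
  calc _ = Real.log (1 + net.singlePower i₀ n₀ i₀ n₀ * x i₀ n₀) := by
        rw [hx₀]; simp [singlePower]
    _ ≤ ∑ n, Real.log (1 + net.singlePower i₀ n₀ i₀ n * x i₀ n) :=
        Finset.single_le_sum (f := fun n => Real.log (1 + net.singlePower i₀ n₀ i₀ n * x i₀ n))
          (fun n _ => hterm i₀ n) (Finset.mem_univ n₀)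
    _ ≤ _ := Finset.single_le_sum
          (f := fun i => ∑ n, Real.log (1 + net.singlePower i₀ n₀ i n * x i n))
          (fun i _ => Finset.sum_nonneg fun n _ => hterm i n) (Finset.mem_univ i₀)

theorem OP_pos (i₀ : Fin B) (n₀ : Fin N) {c h : ℝ} (hc : 0 < c)
    (hh : net.p ^ 2 / net.r₀ ^ 2 < h) : 0 < net.OP N c h := by
  refine (Real.log_pos ?_).trans_le (net.log_le_OP i₀ n₀ hc hh.le)
  have h1 := Real.log_pos (net.one_lt_iff.2 hh)
  have := mul_pos net.Pcon_pos (mul_pos net.maxGain_pos h1)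
  linarith

theorem tendsto_scaled_atTop :
    Tendsto (fun h : ℝ => net.r₀ ^ 2 * h / net.p ^ 2) atTop atTop :=
  (tendsto_id.const_mul_atTop (pow_pos net.r₀_pos 2)).atTop_div_const (pow_pos net.p_pos 2)

theorem tendsto_OP_atTop (i₀ : Fin B) (n₀ : Fin N) {c : ℝ} (hc : 0 < c) :
    Tendsto (net.OP N c) atTop atTop := by
  refine tendsto_atTop_mono' _ ((eventually_ge_atTop _).mono fun h hh =>
    net.log_le_OP i₀ n₀ hc hh) ?_
  refine Real.tendsto_log_atTop.comp (tendsto_atTop_add_const_left _ _ ?_)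
  exact ((Real.tendsto_log_atTop.comp net.tendsto_scaled_atTop).const_mul_atTop
    net.maxGain_pos).const_mul_atTop net.Pcon_pos

theorem OP_mono_left {c₁ c₂ h : ℝ} (hc : 0 < c₁) (hcc : c₁ ≤ c₂)
    (hh : net.p ^ 2 / net.r₀ ^ 2 ≤ h) : net.OP N c₁ h ≤ net.OP N c₂ h := by
  have hc₂ := hc.trans_le hcc
  obtain ⟨q, hq, x, hx, hqx, hOP⟩ := net.exists_OP_eq (N := N) hc hh
  obtain ⟨x', hx', hqx'⟩ := net.exists_solution hc₂ hh hq
  rw [hOP]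
  refine le_trans ?_ (net.opObj_le_OP hc₂ (net.threshold_pos.trans_le hh) hq hx' hqx')
  refine Finset.sum_le_sum fun i _ => Finset.sum_le_sum fun n _ => ?_
  have h0 := hq.1 i n
  have h1 := mul_nonneg h0 (hx i n)
  refine Real.log_le_log (by linarith) ?_
  have := net.constraint_mono hc hcc hq (hx i n) (hx' i n) (hqx i n) (hqx' i n)
  gcongr

/-- Only the quotients `q / pathRatio c` enter the constraint, and `pathRatio c₂ = ρ * pathRatio
c₁`. The powers `q / ρ` therefore keep the same `x`, at a cost of at most the factor `ρ` in each
logarithm. -/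
theorem OP_le_mul_OP {c₁ c₂ h : ℝ} (hc : 0 < c₁) (hcc : c₁ ≤ c₂)
    (hh : net.p ^ 2 / net.r₀ ^ 2 ≤ h) :
    net.OP N c₂ h ≤ (c₂ / c₁) ^ (2 * net.α) * net.OP N c₁ h := by
  have hc₂ := hc.trans_le hcc
  set ρ := (c₂ / c₁) ^ (2 * net.α) with hρ
  have hρ1 : 1 ≤ ρ :=
    Real.one_le_rpow ((one_le_div hc).2 hcc) (by linarith [net.one_lt_α])
  have hρ0 : 0 < ρ := zero_lt_one.trans_le hρ1
  obtain ⟨q, hq, x, hx, hqx, hOP⟩ := net.exists_OP_eq (N := N) hc₂ hh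
  have hq' : (fun i n => q i n / ρ) ∈ net.powerSet N := by
    refine ⟨fun i n => div_nonneg (hq.1 i n) hρ0.le, fun i => ?_⟩
    refine (Finset.sum_le_sum fun n _ => div_le_self (hq.1 i n) hρ1).trans (hq.2 i)
  have hqx' : ∀ i n, net.Constraint c₁ h (fun i n => q i n / ρ) i n (x i n) := by
    intro i n
    have := hqx i n
    rw [constraint_iff, net.pathRatio_eq_mul hc hc₂] at this
    rw [constraint_iff, this]
    simp only [div_div, hρ]
  rw [hOP]
  refine le_trans ?_ (mul_le_mul_of_nonneg_left
    (net.opObj_le_OP hc (net.threshold_pos.trans_le hh) hq' hx hqx') hρ0.le)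
  simp only [opObj, Finset.mul_sum]
  refine Finset.sum_le_sum fun i _ => Finset.sum_le_sum fun n _ => ?_
  have h0 : 0 ≤ q i n / ρ * x i n := mul_nonneg (hq'.1 i n) (hx i n)
  have h1 : q i n * x i n = ρ * (q i n / ρ * x i n) := by field_simp
  rw [h1]
  exact log_one_add_mul_le h0 hρ1

/-! ### The worst-case root `lHat`. -/

section LHat

variable {η : ℝ}

theorem lHat_weight_nonneg (hη : 0 < η) : ∀ j ∈ Finset.range (B - 1),
    0 ≤ (fun _ : ℕ => net.Pcon / net.pathRatio η) j :=
  fun _ _ => div_nonneg net.Pcon_pos.le (net.pathRatio_pos hη).le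

theorem lEquation_iff_eq_lHat (hη : 0 < η) {h : ℝ} (hh : net.p ^ 2 / net.r₀ ^ 2 ≤ h) (l : ℝ) :
    (0 ≤ l ∧ net.LEquation η h l) ↔ l = net.lHat η h := by
  have hex : ∃! l : ℝ, 0 ≤ l ∧ net.LEquation η h l := by
    simp only [lEquation_iff]
    exact existsUnique_expProd_eq net.maxGain_pos (net.lHat_weight_nonneg hη) (net.one_le_iff.2 hh)
  obtain ⟨l₀, hl₀, huniq⟩ := hex
  have hset : {l | 0 ≤ l ∧ net.LEquation η h l} = {l₀} :=
    Set.eq_singleton_iff_unique_mem.2 ⟨hl₀, huniq⟩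
  have : net.lHat η h = l₀ := by rw [lHat, hset, csSup_singleton]
  rw [this]
  exact ⟨huniq l, fun hl => hl ▸ hl₀⟩

theorem lHat_spec (hη : 0 < η) {h : ℝ} (hh : net.p ^ 2 / net.r₀ ^ 2 ≤ h) :
    0 ≤ net.lHat η h ∧ net.r₀ ^ 2 * h / net.p ^ 2 =
      expProd net.maxGain (Finset.range (B - 1)) (fun _ => net.Pcon / net.pathRatio η)
        (net.lHat η h) := by
  have := (net.lEquation_iff_eq_lHat hη hh _).2 rfl
  rwa [lEquation_iff] at this

theorem strictMonoOn_lHat (hη : 0 < η) :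
    StrictMonoOn (net.lHat η) (Ici (net.p ^ 2 / net.r₀ ^ 2)) := by
  intro h₁ hh₁ h₂ hh₂ hlt
  obtain ⟨h1, e1⟩ := net.lHat_spec hη hh₁
  obtain ⟨h2, e2⟩ := net.lHat_spec hη hh₂
  refine ((strictMonoOn_expProd net.maxGain_pos
    (net.lHat_weight_nonneg hη)).lt_iff_lt (s := Ici 0) h1 h2).1 ?_
  rw [← e1, ← e2]
  have := pow_pos net.r₀_pos 2
  have := pow_pos net.p_pos 2
  gcongr

theorem tendsto_lHat_atTop (hη : 0 < η) : Tendsto (net.lHat η) atTop atTop := by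
  refine tendsto_atTop.2 fun M => ?_
  filter_upwards [eventually_ge_atTop (net.p ^ 2 / net.r₀ ^ 2), net.tendsto_scaled_atTop.eventually
    (eventually_ge_atTop (expProd net.maxGain (Finset.range (B - 1))
      (fun _ => net.Pcon / net.pathRatio η) (max M 0)))] with h hh hM
  obtain ⟨h1, e1⟩ := net.lHat_spec hη hh
  rw [e1] at hM
  exact (le_max_left M 0).trans (((strictMonoOn_expProd net.maxGain_pos
    (net.lHat_weight_nonneg hη)).le_iff_le (s := Ici 0) (le_max_right M 0) h1).1 hM)

/-- The equation of `lHat` is the constraint with all `B - 1` interferers at full power. Larger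
weights give a larger function and hence a smaller root, so this is a lower bound on `x` uniform in
the powers. -/
theorem lHat_le_of_constraint (hη : 0 < η) {h x : ℝ} (hh : net.p ^ 2 / net.r₀ ^ 2 ≤ h)
    {q : Fin B → Fin N → ℝ} (hq : q ∈ net.powerSet N) {i : Fin B} {n : Fin N} (hx : 0 ≤ x)
    (hqx : net.Constraint η h q i n x) : net.lHat η h ≤ x := by
  obtain ⟨h1, e1⟩ := net.lHat_spec hη hh
  rw [constraint_iff, e1] at hqx
  have hw : ∀ j ∈ Finset.univ.erase i, 0 ≤ q j n / net.pathRatio η :=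
    fun j _ => net.weight_nonneg hη hq j n
  refine ((strictMonoOn_expProd net.maxGain_pos hw).le_iff_le (s := Ici 0) h1 hx).1 ?_
  rw [← hqx]
  refine (expProd_le_expProd_weight hw (w' := fun _ => net.Pcon / net.pathRatio η)
    (fun j _ => ?_) h1).trans_eq (by simp [expProd])
  exact div_le_div_of_nonneg_right (le_Pcon_of_mem_powerSet hq j n) (net.pathRatio_pos hη).le

end LHat

end Network

end

/-! ### Rayleigh fading at a fixed location. -/

noncomputable section

section ComplexGaussian

open scoped ENNReal

theorem measurable_ofReal_add_mul_I :
    Measurable (fun z : ℝ × ℝ => (z.1 : ℂ) + (z.2 : ℂ) * Complex.I) := by fun_prop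

instance : IsProbabilityMeasure complexGaussian :=
  Measure.isProbabilityMeasure_map measurable_ofReal_add_mul_I.aemeasurable

theorem gaussianPDF_half_mul (x y : ℝ) :
    gaussianPDF 0 (1 / 2) x * gaussianPDF 0 (1 / 2) y =
      ENNReal.ofReal (Real.pi⁻¹ * Real.exp (-(x ^ 2 + y ^ 2))) := by
  rw [gaussianPDF, gaussianPDF, ← ENNReal.ofReal_mul (gaussianPDFReal_nonneg _ _ _)]
  congr 1
  simp only [gaussianPDFReal, sub_zero, NNReal.coe_div, NNReal.coe_one, NNReal.coe_ofNat]
  have h2 : 2 * Real.pi * (1 / 2) = Real.pi := by ring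
  have h3 : (√Real.pi)⁻¹ * (√Real.pi)⁻¹ = Real.pi⁻¹ := by
    rw [← mul_inv, Real.mul_self_sqrt Real.pi_pos.le]
  rw [h2, mul_mul_mul_comm, h3, ← Real.exp_add]
  congr 2
  ring

/-- Under `CN(0,1)`, the squared modulus is exponentially distributed with mean `1`. -/
theorem lintegral_complexGaussian_norm_sq {f : ℝ → ℝ≥0∞} (hf : Measurable f) :
    ∫⁻ z, f (‖z‖ ^ 2) ∂complexGaussian =
      ∫⁻ t in Ioi (0 : ℝ), f t * ENNReal.ofReal (Real.exp (-t)) := by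
  have hv : (1 / 2 : NNReal) ≠ 0 := by norm_num
  have hmeas : Measurable fun p : ℝ × ℝ => f (p.1 ^ 2 + p.2 ^ 2) := hf.comp (by fun_prop)
  have hnorm : ∀ p : ℝ × ℝ, ‖(p.1 : ℂ) + (p.2 : ℂ) * Complex.I‖ ^ 2 = p.1 ^ 2 + p.2 ^ 2 := by
    intro p
    rw [← Complex.normSq_eq_norm_sq, Complex.normSq_add_mul_I]
  have himage : (fun r : ℝ => r ^ 2) '' Ioi 0 = Ioi 0 := by
    ext t
    constructor
    · rintro ⟨r, hr, rfl⟩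
      exact pow_pos (mem_Ioi.1 hr) 2
    · intro ht
      exact ⟨√t, Real.sqrt_pos.2 ht, Real.sq_sqrt (le_of_lt ht)⟩
  have hinj : InjOn (fun r : ℝ => r ^ 2) (Ioi 0) := fun a ha b hb hab =>
    (pow_left_inj₀ (le_of_lt ha) (le_of_lt hb) two_ne_zero).1 hab
  calc ∫⁻ z, f (‖z‖ ^ 2) ∂complexGaussian
      = ∫⁻ p : ℝ × ℝ, f (p.1 ^ 2 + p.2 ^ 2)
          ∂((gaussianReal 0 (1 / 2)).prod (gaussianReal 0 (1 / 2))) := by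
        rw [complexGaussian, lintegral_map (f := fun z : ℂ => f (‖z‖ ^ 2))
          (hf.comp (by fun_prop)) measurable_ofReal_add_mul_I]
        simp only [hnorm]
    _ = ∫⁻ p : ℝ × ℝ, ENNReal.ofReal (Real.pi⁻¹ * Real.exp (-(p.1 ^ 2 + p.2 ^ 2))) *
          f (p.1 ^ 2 + p.2 ^ 2) := by
        rw [gaussianReal_of_var_ne_zero _ hv,
          prod_withDensity (measurable_gaussianPDF _ _) (measurable_gaussianPDF _ _),
          lintegral_withDensity_eq_lintegral_mul _ _ hmeas]
        · refine lintegral_congr fun p => ?_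
          simp only [Pi.mul_apply, gaussianPDF_half_mul]
        · fun_prop
    _ = ∫⁻ p : ℝ × ℝ in Ioi (0 : ℝ) ×ˢ Ioo (-Real.pi) Real.pi, ENNReal.ofReal p.1 *
          (ENNReal.ofReal (Real.pi⁻¹ * Real.exp (-(p.1 ^ 2))) * f (p.1 ^ 2)) := by
        -- Polar coordinates: the angular integral `2π` cancels `π⁻¹` up to the factor `2`, which is
        -- what the Jacobian `2 r` of the final substitution `t = r²` needs.
        rw [← lintegral_comp_polarCoord_symm, polarCoord_target]
        refine lintegral_congr fun p => ?_
        have : (p.1 * Real.cos p.2) ^ 2 + (p.1 * Real.sin p.2) ^ 2 = p.1 ^ 2 := by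
          rw [mul_pow, mul_pow, ← mul_add, Real.cos_sq_add_sin_sq, mul_one]
        simp only [polarCoord_symm_apply, this, smul_eq_mul]
    _ = ∫⁻ r in Ioi (0 : ℝ), ENNReal.ofReal |2 * r| *
          (f (r ^ 2) * ENNReal.ofReal (Real.exp (-(r ^ 2)))) := by
        rw [Measure.volume_eq_prod, setLIntegral_prod _ (by fun_prop)]
        refine setLIntegral_congr_fun measurableSet_Ioi fun r hr => ?_
        have hr : 0 < r := hr
        simp only [lintegral_const, Measure.restrict_apply MeasurableSet.univ, univ_inter,
          Real.volume_Ioo]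
        rw [abs_of_pos (by positivity : 0 < 2 * r), ENNReal.ofReal_mul (by positivity : 0 ≤ Real.pi⁻¹)]
        have : ENNReal.ofReal (2 * r) = ENNReal.ofReal r * (ENNReal.ofReal Real.pi⁻¹ *
            ENNReal.ofReal (Real.pi - -Real.pi)) := by
          rw [← ENNReal.ofReal_mul (by positivity), ← ENNReal.ofReal_mul hr.le]
          congr 1
          field_simp
          ring
        rw [this]
        ring
    _ = _ := by
        rw [← lintegral_image_eq_lintegral_abs_deriv_mul measurableSet_Ioi
          (f := fun r : ℝ => r ^ 2) (f' := fun r => 2 * r)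
          (fun r _ => by simpa using (hasDerivAt_pow 2 r).hasDerivWithinAt) hinj
          (fun t => f t * ENNReal.ofReal (Real.exp (-t))), himage]

theorem lintegral_Ioi_exp_neg (b : ℝ) :
    ∫⁻ t in Ioi b, ENNReal.ofReal (Real.exp (-t)) = ENNReal.ofReal (Real.exp (-b)) := by
  rw [← ofReal_integral_eq_lintegral_ofReal (integrableOn_exp_neg_Ioi b)
    (ae_of_all _ fun t => (Real.exp_pos _).le), integral_exp_neg_Ioi]

theorem complexGaussian_le_norm_sq {b : ℝ} (hb : 0 ≤ b) :
    complexGaussian {z | b ≤ ‖z‖ ^ 2} = ENNReal.ofReal (Real.exp (-b)) := by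
  have hs : MeasurableSet {z : ℂ | b ≤ ‖z‖ ^ 2} := measurableSet_le (by fun_prop) (by fun_prop)
  rw [← lintegral_indicator_one hs]
  have h1 := lintegral_complexGaussian_norm_sq
    (f := (Ici b).indicator 1) (measurable_one.indicator measurableSet_Ici)
  refine Eq.trans ?_ (h1.trans ?_)
  · rfl
  · have : ∀ t : ℝ, (Ici b).indicator (1 : ℝ → ℝ≥0∞) t * ENNReal.ofReal (Real.exp (-t)) =
        (Ici b).indicator (fun t => ENNReal.ofReal (Real.exp (-t))) t := by
      intro t
      by_cases ht : t ∈ Ici b <;> simp [ht]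
    simp only [this]
    rw [← lintegral_Ioi_exp_neg b, setLIntegral_congr (Ioi_ae_eq_Ici (a := (0 : ℝ))),
      setLIntegral_indicator measurableSet_Ici, setLIntegral_congr (Ioi_ae_eq_Ici (a := b)),
      Ici_inter_Ici, sup_of_le_left hb]

/-- Laplace transform of the exponential law; it becomes the factor of one interferer in `expProd`.
-/
theorem lintegral_complexGaussian_exp {s : ℝ} (hs : 0 ≤ s) :
    ∫⁻ z, ENNReal.ofReal (Real.exp (-(s * ‖z‖ ^ 2))) ∂complexGaussian =
      ENNReal.ofReal (1 + s)⁻¹ := by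
  have hs1 : -(1 + s) < 0 := by linarith
  rw [lintegral_complexGaussian_norm_sq (f := fun t => ENNReal.ofReal (Real.exp (-(s * t))))
    (by fun_prop)]
  have : ∀ t : ℝ, ENNReal.ofReal (Real.exp (-(s * t))) * ENNReal.ofReal (Real.exp (-t)) =
      ENNReal.ofReal (Real.exp (-(1 + s) * t)) := by
    intro t
    rw [← ENNReal.ofReal_mul (Real.exp_pos _).le, ← Real.exp_add]
    congr 2
    ring
  simp only [this]
  rw [← ofReal_integral_eq_lintegral_ofReal (integrableOn_exp_mul_Ioi hs1 0)
    (ae_of_all _ fun t => (Real.exp_pos _).le), integral_exp_mul_Ioi hs1]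
  simp only [mul_zero, Real.exp_zero, neg_div_neg_eq, one_div]

/-- Memorylessness of the exponential law: the mean excess is the mean `c` times the tail at `x`.
`ENNReal.ofReal` truncates at zero, so the integrand is the positive part. -/
theorem lintegral_complexGaussian_excess {c x : ℝ} (hc : 0 < c) (hx : 0 ≤ x) :
    ∫⁻ z, ENNReal.ofReal (c * ‖z‖ ^ 2 - x) ∂complexGaussian =
      ENNReal.ofReal (c * Real.exp (-(x / c))) := by
  have h1 : ∀ z : ℂ, ENNReal.ofReal (c * ‖z‖ ^ 2 - x) =
      ENNReal.ofReal c * ENNReal.ofReal (max (‖z‖ ^ 2 - x / c) 0) := by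
    intro z
    rw [ENNReal.ofReal_max, ENNReal.ofReal_zero, max_eq_left zero_le,
      ← ENNReal.ofReal_mul hc.le]
    congr 1
    field_simp
  simp only [h1]
  rw [lintegral_const_mul _ (by fun_prop), ENNReal.ofReal_mul hc.le]
  congr 1
  -- Layer-cake formula, which reduces the mean excess to the tail probabilities.
  rw [lintegral_eq_lintegral_meas_le _ 
    (f := fun z : ℂ => max (‖z‖ ^ 2 - x / c) 0) (ae_of_all _ fun z => le_max_right _ _)
    (by fun_prop)]
  have h2 : ∀ t ∈ Ioi (0 : ℝ), complexGaussian {z | t ≤ max (‖z‖ ^ 2 - x / c) 0} =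
      ENNReal.ofReal (Real.exp (-(x / c))) * ENNReal.ofReal (Real.exp (-t)) := by
    intro t ht
    have ht : 0 < t := ht
    have hset : {z : ℂ | t ≤ max (‖z‖ ^ 2 - x / c) 0} = {z | t + x / c ≤ ‖z‖ ^ 2} := by
      ext z
      simp [ht.not_ge, le_sub_iff_add_le]
    rw [hset, complexGaussian_le_norm_sq (by positivity), ← ENNReal.ofReal_mul (Real.exp_pos _).le,
      ← Real.exp_add]
    congr 2
    ring
  rw [setLIntegral_congr_fun measurableSet_Ioi h2, lintegral_const_mul _ (by fun_prop),
    lintegral_Ioi_exp_neg]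
  simp

theorem integrable_norm_sq_complexGaussian :
    Integrable (fun z : ℂ => ‖z‖ ^ 2) complexGaussian := by
  refine ⟨by fun_prop, ?_⟩
  rw [hasFiniteIntegral_iff_ofReal (ae_of_all _ fun z => by positivity)]
  have := lintegral_complexGaussian_excess zero_lt_one le_rfl
  simp only [one_mul, sub_zero] at this
  rw [this]
  exact ENNReal.ofReal_lt_top

end ComplexGaussian

section Pi

open scoped ENNReal

/-- Resampling one coordinate does not change the integral. This is Fubini's theorem in a form
suited to conditioning on all coordinates but `i`. -/
theorem lintegral_pi_update {ι : Type*} [Fintype ι] [DecidableEq ι] {X : ι → Type*}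
    [∀ i, MeasurableSpace (X i)] (μ : ∀ i, Measure (X i)) [∀ i, IsProbabilityMeasure (μ i)]
    (i : ι) {f : (∀ i, X i) → ℝ≥0∞} (hf : Measurable f) :
    ∫⁻ z, f z ∂(Measure.pi μ) = ∫⁻ z, ∫⁻ y, f (Function.update z i y) ∂(μ i) ∂(Measure.pi μ) := by
  have hg : Measurable fun z => ∫⁻ y, f (Function.update z i y) ∂(μ i) := by
    refine Measurable.lintegral_prod_right' (f := fun p : (∀ i, X i) × X i =>
      f (Function.update p.1 i p.2)) (hf.comp ?_)
    exact measurable_update'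
  refine lintegral_eq_of_lmarginal_eq {i} hf hg ?_
  simp [lmarginal_singleton]

variable {ι : Type*} [Fintype ι] [DecidableEq ι]

/-- The noise contributes `e^{-x/g}`, and independence turns the interference into a product of
Laplace transforms. -/
theorem lintegral_pi_complexGaussian_exp (i : ι) {g x : ℝ} (hg : 0 < g) (hx : 0 ≤ x) {w : ι → ℝ}
    (hw : ∀ j, 0 ≤ w j) :
    ∫⁻ z : ι → ℂ, ENNReal.ofReal
      (Real.exp (-(x * (1 + ∑ j ∈ Finset.univ.erase i, w j * ‖z j‖ ^ 2) / g)))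
        ∂(Measure.pi fun _ => complexGaussian) =
      ENNReal.ofReal (expProd g (Finset.univ.erase i) (fun j => w j / g) x)⁻¹ := by
  have h1 : ∀ z : ι → ℂ, ENNReal.ofReal
      (Real.exp (-(x * (1 + ∑ j ∈ Finset.univ.erase i, w j * ‖z j‖ ^ 2) / g))) =
      ENNReal.ofReal (Real.exp (-(x / g))) * ∏ j ∈ Finset.univ.erase i,
        ENNReal.ofReal (Real.exp (-(w j / g * x * ‖z j‖ ^ 2))) := by
    intro z
    rw [← ENNReal.ofReal_prod_of_nonneg fun j _ => (Real.exp_pos _).le,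
      ← ENNReal.ofReal_mul (Real.exp_pos _).le, ← Real.exp_sum, ← Real.exp_add]
    congr 2
    rw [Finset.sum_neg_distrib, mul_add, Finset.mul_sum, add_div, Finset.sum_div, neg_add]
    congr 2
    · ring
    · exact Finset.sum_congr rfl fun j _ => by ring
  have hind : iIndepFun (fun (j : ι) (z : ι → ℂ) =>
      ENNReal.ofReal (Real.exp (-(w j / g * x * ‖z j‖ ^ 2))))
      (Measure.pi fun _ : ι => complexGaussian) :=
    iIndepFun_pi (X := fun j (y : ℂ) => ENNReal.ofReal (Real.exp (-(w j / g * x * ‖y‖ ^ 2))))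
      fun j => by fun_prop
  have hpos : ∀ j, 0 ≤ w j / g * x := fun j => mul_nonneg (div_nonneg (hw j) hg.le) hx
  have h2 : ∀ j, ∫⁻ z : ι → ℂ, ENNReal.ofReal (Real.exp (-(w j / g * x * ‖z j‖ ^ 2)))
      ∂(Measure.pi fun _ => complexGaussian) = ENNReal.ofReal (1 + w j / g * x)⁻¹ := by
    intro j
    rw [← lintegral_complexGaussian_exp (hpos j)]
    exact (measurePreserving_eval (fun _ : ι => complexGaussian) j).lintegral_comp
      (f := fun y : ℂ => ENNReal.ofReal (Real.exp (-(w j / g * x * ‖y‖ ^ 2)))) (by fun_prop)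
  simp only [h1]
  rw [lintegral_const_mul _ (by fun_prop),
    lintegral_prod_eq_prod_lintegral_of_indepFun _ _ hind (fun j => by fun_prop)]
  simp only [h2]
  rw [← ENNReal.ofReal_prod_of_nonneg fun j _ => inv_nonneg.2 (by linarith [hpos j]),
    ← ENNReal.ofReal_mul (Real.exp_pos _).le, expProd, mul_inv, Real.exp_neg,
    Finset.prod_inv_distrib]

/-- Given the interference `I`, the event says that `‖z i‖ ^ 2` is at least `x (1 + I) / g`, of
probability `e^{-x(1 + I)/g}`; the previous lemma averages this over `I`. -/
theorem pi_complexGaussian_sinr_ge (i : ι) {g x : ℝ} (hg : 0 < g) (hx : 0 ≤ x) {w : ι → ℝ}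
    (hw : ∀ j, 0 ≤ w j) :
    (Measure.pi fun _ : ι => complexGaussian)
      {z | x ≤ g * ‖z i‖ ^ 2 / (1 + ∑ j ∈ Finset.univ.erase i, w j * ‖z j‖ ^ 2)} =
      ENNReal.ofReal (expProd g (Finset.univ.erase i) (fun j => w j / g) x)⁻¹ := by
  have hs : MeasurableSet {z : ι → ℂ |
      x ≤ g * ‖z i‖ ^ 2 / (1 + ∑ j ∈ Finset.univ.erase i, w j * ‖z j‖ ^ 2)} :=
    measurableSet_le (by fun_prop) (by fun_prop)
  rw [← lintegral_indicator_one hs, lintegral_pi_update _ i (measurable_one.indicator hs),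
    ← lintegral_pi_complexGaussian_exp i hg hx hw]
  refine lintegral_congr fun z => ?_
  have hpos : 0 < 1 + ∑ j ∈ Finset.univ.erase i, w j * ‖z j‖ ^ 2 :=
    add_pos_of_pos_of_nonneg one_pos
      (Finset.sum_nonneg fun j _ => mul_nonneg (hw j) (by positivity))
  have hS : ∀ y : ℂ, ∑ j ∈ Finset.univ.erase i, w j * ‖Function.update z i y j‖ ^ 2 =
      ∑ j ∈ Finset.univ.erase i, w j * ‖z j‖ ^ 2 := fun y =>
    Finset.sum_congr rfl fun j hj => by rw [Function.update_of_ne (Finset.ne_of_mem_erase hj)]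
  rw [← complexGaussian_le_norm_sq (by positivity), ← lintegral_indicator_one
    (measurableSet_le (by fun_prop) (by fun_prop))]
  refine lintegral_congr fun y => ?_
  simp only [indicator_apply, mem_ofPred_eq, Function.update_self, hS, le_div_iff₀ hpos,
    div_le_iff₀ hg, mul_comm g, Pi.one_apply]

/-- Given the interference `I`, the ratio is exponential with mean `g / (1 + I) ≤ g`, so its mean
excess is at most `g` times its tail at `x`. -/
theorem lintegral_pi_complexGaussian_excess_le (i : ι) {g x : ℝ} (hg : 0 < g) (hx : 0 ≤ x)
    {w : ι → ℝ} (hw : ∀ j, 0 ≤ w j) :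
    ∫⁻ z : ι → ℂ, ENNReal.ofReal
      (g * ‖z i‖ ^ 2 / (1 + ∑ j ∈ Finset.univ.erase i, w j * ‖z j‖ ^ 2) - x)
        ∂(Measure.pi fun _ => complexGaussian) ≤
      ENNReal.ofReal (g * (expProd g (Finset.univ.erase i) (fun j => w j / g) x)⁻¹) := by
  rw [lintegral_pi_update _ i (by fun_prop), ENNReal.ofReal_mul hg.le,
    ← lintegral_pi_complexGaussian_exp i hg hx hw, ← lintegral_const_mul _ (by fun_prop)]
  refine lintegral_mono fun z => ?_
  have hS0 : 0 ≤ ∑ j ∈ Finset.univ.erase i, w j * ‖z j‖ ^ 2 :=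
    Finset.sum_nonneg fun j _ => mul_nonneg (hw j) (by positivity)
  have hS : ∀ y : ℂ, ∑ j ∈ Finset.univ.erase i, w j * ‖Function.update z i y j‖ ^ 2 =
      ∑ j ∈ Finset.univ.erase i, w j * ‖z j‖ ^ 2 := fun y =>
    Finset.sum_congr rfl fun j hj => by rw [Function.update_of_ne (Finset.ne_of_mem_erase hj)]
  simp only [hS, Function.update_self, mul_div_right_comm g]
  rw [lintegral_complexGaussian_excess (by positivity) hx, ← ENNReal.ofReal_mul hg.le]
  refine ENNReal.ofReal_le_ofReal ?_
  rw [div_div_eq_mul_div]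
  exact mul_le_mul_of_nonneg_right (div_le_self hg.le (by linarith)) (Real.exp_pos _).le

end Pi

end

/-! ### The law of one user, averaged over its location. -/

noncomputable section

/-- Restricting an i.i.d. array to a slice and grouping by one index gives i.i.d. groups. -/
theorem measurePreserving_slice {ι κ τ X : Type*} [Fintype ι] [Fintype κ] [Fintype τ]
    [DecidableEq τ] [MeasurableSpace X] (μ : Measure X) [IsProbabilityMeasure μ] (n : τ) :
    MeasurePreserving (fun (ν : ι × κ × τ → X) (k : κ) (j : ι) => ν (j, k, n))
      (Measure.pi fun _ => μ) (Measure.pi fun _ : κ => Measure.pi fun _ : ι => μ) := by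
  have hm : Measurable (fun (ν : ι × κ × τ → X) (k : κ) (j : ι) => ν (j, k, n)) := by fun_prop
  refine ⟨hm, (Measure.pi_eq_generateFrom
    (C := fun _ => pi univ '' pi univ fun _ : ι => {s : Set X | MeasurableSet s})
    (fun _ => generateFrom_pi) (fun _ => isPiSystem_pi)
    (fun _ => Measure.FiniteSpanningSetsIn.pi fun _ => μ.toFiniteSpanningSetsIn) ?_).symm⟩
  intro s hs
  choose t ht hts using hs
  obtain rfl : (fun k => pi univ (t k)) = s := funext hts
  -- The preimage of a box is again a box, unrestricted on the other resource blocks; those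
  -- coordinates contribute factors `1` to its measure.
  have hpre : (fun (ν : ι × κ × τ → X) (k : κ) (j : ι) => ν (j, k, n)) ⁻¹'
      pi univ (fun k => pi univ (t k)) =
      pi univ fun e : ι × κ × τ => if e.2.2 = n then t e.2.1 e.1 else univ := by
    ext ν
    simp only [mem_preimage, mem_univ_pi, Prod.forall]
    constructor
    · intro h j k m
      split_ifs with hmn
      · exact hmn ▸ h k j
      · trivial
    · intro h k j
      simpa using h j k n
  rw [Measure.map_apply hm (MeasurableSet.univ_pi fun k => MeasurableSet.univ_pi fun j =>
    ht k j trivial), hpre, Measure.pi_pi]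
  simp only [Measure.pi_pi, Fintype.prod_prod_type]
  rw [Finset.prod_comm]
  refine Finset.prod_congr rfl fun k _ => Finset.prod_congr rfl fun j _ => ?_
  rw [Finset.prod_eq_single n (fun m _ hmn => by simp [hmn]) (by simp)]
  simp

namespace Network

variable {B : ℕ} (net : Network B) {N K : ℕ}

instance : IsProbabilityMeasure net.userLaw := by
  refine cond_isProbabilityMeasure_of_finite ?_ ?_
  · exact (Metric.measure_closedBall_pos volume 0 net.p_pos).ne'
  · exact measure_closedBall_lt_top.ne

/-- The law of the location and of the fading factors, on one resource block, of one user. -/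
def userMeasure : Measure (EuclideanSpace ℝ (Fin 2) × (Fin B → ℂ)) :=
  net.userLaw.prod (Measure.pi fun _ => complexGaussian)

instance : IsProbabilityMeasure net.userMeasure := by unfold userMeasure; infer_instance

instance : IsProbabilityMeasure (net.law N K) := by unfold law; infer_instance

/-- What each user sees on resource block `n`. -/
def userView (n : Fin N) (ω : Sample B N K) (k : Fin K) :
    EuclideanSpace ℝ (Fin 2) × (Fin B → ℂ) :=
  (ω.1 k, fun j => ω.2 (j, k, n))

theorem measurePreserving_userView (n : Fin N) :
    MeasurePreserving (userView n) (net.law N K) (Measure.pi fun _ => net.userMeasure) := by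
  have h1 := (MeasurePreserving.id (Measure.pi fun _ : Fin K => net.userLaw)).prod
    (measurePreserving_slice (ι := Fin B) (κ := Fin K) complexGaussian n)
  exact ((measurePreserving_arrowProdEquivProdArrow (EuclideanSpace ℝ (Fin 2)) (Fin B → ℂ) (Fin K)
    (fun _ => net.userLaw) (fun _ => Measure.pi fun _ => complexGaussian)).symm _).comp h1

theorem measurePreserving_userView_apply (n : Fin N) (k : Fin K) :
    MeasurePreserving (fun ω => userView n ω k) (net.law N K) net.userMeasure :=
  (measurePreserving_eval (fun _ => net.userMeasure) k).comp (net.measurePreserving_userView n)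

/-- The mean SNR from transmitter `i` at location `y`. -/
def gain (y : EuclideanSpace ℝ (Fin 2)) (i : Fin B) : ℝ :=
  net.β ^ 2 * (max net.r₀ (dist y (net.tx i))) ^ (-(2 * net.α))

section Gain

variable (y : EuclideanSpace ℝ (Fin 2)) (i : Fin B)

theorem gain_pos : 0 < net.gain y i :=
  mul_pos (pow_pos net.β_pos 2) (Real.rpow_pos_of_pos (lt_max_of_lt_left net.r₀_pos) _)

theorem gain_le_maxGain : net.gain y i ≤ net.maxGain :=
  mul_le_mul_of_nonneg_left (Real.rpow_le_rpow_of_nonpos net.r₀_pos (le_max_left _ _)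
    (by linarith [net.one_lt_α])) (pow_pos net.β_pos 2).le

variable {y i}

theorem gain_eq_maxGain (h : dist y (net.tx i) ≤ net.r₀) : net.gain y i = net.maxGain := by
  rw [gain, maxGain, max_eq_left h]

/-- The left side equals `β² (2p)^{-2α}`, and every user is within `p + (p - R) ≤ 2p` of every
transmitter. -/
theorem maxGain_div_pathRatio_le_gain (h : y ∈ Metric.closedBall 0 net.p) :
    net.maxGain / net.pathRatio (2 * net.p) ≤ net.gain y i := by
  have hp := net.p_pos
  have h2p : max net.r₀ (dist y (net.tx i)) ≤ 2 * net.p := by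
    have h1 := net.tx_mem i
    rw [Metric.mem_closedBall] at h h1
    have h2 := dist_triangle_right y (net.tx i) 0
    have := net.r₀_pos
    have := net.r₀_lt_R
    have := net.R_lt_p
    exact max_le (by linarith) (by linarith)
  have hr := Real.rpow_pos_of_pos net.r₀_pos (-(2 * net.α))
  have hq := Real.rpow_pos_of_pos (show 0 < 2 * net.p by linarith) (2 * net.α)
  have : net.maxGain / net.pathRatio (2 * net.p) =
      net.β ^ 2 * (2 * net.p) ^ (-(2 * net.α)) := by
    rw [maxGain, pathRatio, Real.rpow_neg (show 0 ≤ 2 * net.p by linarith) (2 * net.α)]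
    field_simp
  rw [this, gain]
  exact mul_le_mul_of_nonneg_left (Real.rpow_le_rpow_of_nonpos (lt_max_of_lt_left net.r₀_pos) h2p
    (by linarith [net.one_lt_α])) (pow_pos net.β_pos 2).le

end Gain

theorem measurable_gain (i : Fin B) : Measurable fun y => net.gain y i := by
  unfold gain
  fun_prop

/-- The signal-to-interference ratio of a user with respect to transmitter `i`, per unit of power
of that transmitter, for powers `w` of the transmitters. -/
def sinr (w : Fin B → ℝ) (i : Fin B) (v : EuclideanSpace ℝ (Fin 2) × (Fin B → ℂ)) : ℝ :=
  net.gain v.1 i * ‖v.2 i‖ ^ 2 /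
    (1 + ∑ j ∈ Finset.univ.erase i, net.gain v.1 j * w j * ‖v.2 j‖ ^ 2)

theorem measurable_sinr (w : Fin B → ℝ) (i : Fin B) : Measurable (net.sinr w i) := by
  have := net.measurable_gain
  unfold sinr
  fun_prop

theorem sinr_nonneg {w : Fin B → ℝ} (hw : ∀ j, 0 ≤ w j) (i : Fin B)
    (v : EuclideanSpace ℝ (Fin 2) × (Fin B → ℂ)) : 0 ≤ net.sinr w i v := by
  have h : ∀ j, 0 ≤ net.gain v.1 j := fun j => (net.gain_pos _ _).le
  have := Finset.sum_nonneg (s := Finset.univ.erase i)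
    fun j _ => mul_nonneg (mul_nonneg (h j) (hw j)) (sq_nonneg ‖v.2 j‖)
  exact div_nonneg (mul_nonneg (h i) (sq_nonneg _)) (by linarith)

theorem sinr_le {w : Fin B → ℝ} (hw : ∀ j, 0 ≤ w j) (i : Fin B)
    (v : EuclideanSpace ℝ (Fin 2) × (Fin B → ℂ)) : net.sinr w i v ≤ net.maxGain * ‖v.2 i‖ ^ 2 := by
  have h : ∀ j, 0 ≤ net.gain v.1 j := fun j => (net.gain_pos _ _).le
  have := Finset.sum_nonneg (s := Finset.univ.erase i)
    fun j _ => mul_nonneg (mul_nonneg (h j) (hw j)) (sq_nonneg ‖v.2 j‖)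
  refine (div_le_self (mul_nonneg (h i) (sq_nonneg _)) (by linarith)).trans ?_
  exact mul_le_mul_of_nonneg_right (net.gain_le_maxGain _ _) (sq_nonneg _)

theorem snr_mul_div_eq (q : Fin B → Fin N → ℝ) (ω : Sample B N K) (i : Fin B) (k : Fin K)
    (n : Fin N) :
    net.snr ω i k n * q i n / (1 + ∑ j ∈ Finset.univ.erase i, net.snr ω j k n * q j n) =
      q i n * net.sinr (fun j => q j n) i (userView n ω k) := by
  have : ∑ j ∈ Finset.univ.erase i, net.snr ω j k n * q j n =
      ∑ j ∈ Finset.univ.erase i, net.gain (ω.1 k) j * q j n * ‖ω.2 (j, k, n)‖ ^ 2 :=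
    Finset.sum_congr rfl fun j _ => by rw [snr, gain]; ring
  rw [this, sinr, userView, snr, gain]
  ring

theorem userLaw_closedBall_tx (i : Fin B) :
    net.userLaw (Metric.closedBall (net.tx i) net.r₀) =
      ENNReal.ofReal (net.r₀ ^ 2 / net.p ^ 2) := by
  -- Since `r₀ < R`, the disc about the transmitter does not cross the boundary of the cell, and its
  -- probability is a ratio of areas.
  have hsub : Metric.closedBall (net.tx i) net.r₀ ⊆ Metric.closedBall 0 net.p := by
    refine Metric.closedBall_subset_closedBall' ?_
    have h1 := net.tx_mem i
    rw [Metric.mem_closedBall] at h1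
    linarith [net.r₀_lt_R]
  have hp := net.p_pos
  have hfin : Module.finrank ℝ (EuclideanSpace ℝ (Fin 2)) = 2 := by simp
  have hb0 : volume (Metric.ball (0 : EuclideanSpace ℝ (Fin 2)) 1) ≠ 0 :=
    (Metric.measure_ball_pos volume 0 one_pos).ne'
  have hbt : volume (Metric.ball (0 : EuclideanSpace ℝ (Fin 2)) 1) ≠ ⊤ := measure_ball_lt_top.ne
  rw [userLaw, cond_apply measurableSet_closedBall, inter_eq_right.2 hsub,
    Measure.addHaar_closedBall _ _ net.r₀_pos.le, Measure.addHaar_closedBall _ _ hp.le, hfin,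
    mul_comm, ← div_eq_mul_inv, ENNReal.mul_div_mul_right _ _ hb0 hbt,
    ENNReal.ofReal_div_of_pos (by positivity)]

theorem ae_userLaw_mem : ∀ᵐ y ∂net.userLaw, y ∈ Metric.closedBall 0 net.p :=
  ae_cond_mem measurableSet_closedBall

/-- Keep only users within `r₀` of transmitter `i`, an event of probability `r₀²/p²`. There the gain
ratios are at most one, so the constraint with `c = r₀` overestimates the interference and the tail
is at least `p²/(r₀² h)`. -/
theorem le_userMeasure_sinr_ge {h x : ℝ} (hh : 0 < h) (hx : 0 ≤ x) {q : Fin B → Fin N → ℝ}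
    (hq : q ∈ net.powerSet N) {i : Fin B} {n : Fin N} (hqx : net.Constraint net.r₀ h q i n x) :
    ENNReal.ofReal h⁻¹ ≤ net.userMeasure {v | x ≤ net.sinr (fun j => q j n) i v} := by
  have hs : MeasurableSet {v | x ≤ net.sinr (fun j => q j n) i v} :=
    measurableSet_le measurable_const (net.measurable_sinr _ i)
  rw [constraint_iff] at hqx
  set G := expProd net.maxGain (Finset.univ.erase i) (fun j => q j n / net.pathRatio net.r₀) x
    with hG
  have hr := net.r₀_pos
  have hp := net.p_pos
  have ha := net.maxGain_pos
  rw [userMeasure, Measure.prod_apply hs]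
  calc ENNReal.ofReal h⁻¹
      = ENNReal.ofReal G⁻¹ * net.userLaw (Metric.closedBall (net.tx i) net.r₀) := by
        rw [userLaw_closedBall_tx, ← ENNReal.ofReal_mul (by rw [← hqx]; positivity), ← hqx]
        congr 1
        field_simp
    _ = ∫⁻ _y in Metric.closedBall (net.tx i) net.r₀, ENNReal.ofReal G⁻¹ ∂net.userLaw := by
        rw [setLIntegral_const]
    _ ≤ ∫⁻ y in Metric.closedBall (net.tx i) net.r₀, (Measure.pi fun _ => complexGaussian)
          (Prod.mk y ⁻¹' {v | x ≤ net.sinr (fun j => q j n) i v}) ∂net.userLaw := by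
        refine setLIntegral_mono' measurableSet_closedBall fun y hy => ?_
        have hgi : net.gain y i = net.maxGain := net.gain_eq_maxGain hy
        have hw : ∀ j, 0 ≤ net.gain y j * q j n :=
          fun j => mul_nonneg (net.gain_pos y j).le (hq.1 j n)
        refine le_of_le_of_eq (ENNReal.ofReal_le_ofReal ?_)
          (pi_complexGaussian_sinr_ge i (net.gain_pos y i) hx hw).symm
        have hw' : ∀ j ∈ Finset.univ.erase i, 0 ≤ net.gain y j * q j n / net.gain y i :=
          fun j _ => div_nonneg (hw j) (net.gain_pos y i).le
        rw [hG, hgi]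
        rw [hgi] at hw'
        refine inv_anti₀ (expProd_pos hw' hx) (expProd_le_expProd_weight hw' (fun j _ => ?_) hx)
        rw [pathRatio_r₀, div_one, div_le_iff₀ ha, mul_comm]
        exact mul_le_mul_of_nonneg_left (net.gain_le_maxGain y j) (hq.1 j n)
    _ ≤ _ := setLIntegral_le_lintegral _ _

/-- Almost every location satisfies `maxGain / pathRatio (2p) ≤ gain ≤ maxGain`, so the constraint
with `c = 2p` underestimates the interference. The tail at `x` is then at most `p²/(r₀² h)` at every
such location. -/
theorem lintegral_sinr_excess_le {h x : ℝ} (hx : 0 ≤ x) {q : Fin B → Fin N → ℝ}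
    (hq : q ∈ net.powerSet N) {i : Fin B} {n : Fin N}
    (hqx : net.Constraint (2 * net.p) h q i n x) :
    ∫⁻ v, ENNReal.ofReal (net.sinr (fun j => q j n) i v - x) ∂net.userMeasure ≤
      ENNReal.ofReal (net.maxGain * (net.r₀ ^ 2 * h / net.p ^ 2)⁻¹) := by
  rw [constraint_iff] at hqx
  have hp : 0 < 2 * net.p := by linarith [net.p_pos]
  have ha := net.maxGain_pos
  have hwp : ∀ j ∈ Finset.univ.erase i, 0 ≤ q j n / net.pathRatio (2 * net.p) :=
    fun j _ => net.weight_nonneg hp hq j n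
  rw [userMeasure, lintegral_prod _ (by have := net.measurable_sinr (fun j => q j n) i; fun_prop)]
  refine (lintegral_mono_ae (g := fun _ => ENNReal.ofReal
    (net.maxGain * (net.r₀ ^ 2 * h / net.p ^ 2)⁻¹)) ?_).trans (by simp)
  filter_upwards [net.ae_userLaw_mem] with y hy
  have hg := net.gain_pos y i
  have hga := net.gain_le_maxGain y i
  have hw : ∀ j, 0 ≤ net.gain y j * q j n :=
    fun j => mul_nonneg (net.gain_pos y j).le (hq.1 j n)
  refine (lintegral_pi_complexGaussian_excess_le i hg hx hw).trans (ENNReal.ofReal_le_ofReal ?_)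
  rw [hqx]
  refine mul_le_mul hga (inv_anti₀ (expProd_pos hwp hx) ?_)
    (inv_nonneg.2 (expProd_pos (fun j _ => div_nonneg (hw j) hg.le) hx).le) ha.le
  -- First lower the signal gain in the exponential, then raise the weights `q j n / pathRatio (2p)`
  -- to the actual `gain j * q j n / gain i`.
  refine le_trans (b := expProd (net.gain y i) (Finset.univ.erase i)
    (fun j => q j n / net.pathRatio (2 * net.p)) x) ?_ ?_
  · refine mul_le_mul_of_nonneg_right (Real.exp_le_exp.2 ?_)
      (zero_le_one.trans (one_le_prod_one_add_mul hwp hx))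
    gcongr
  · refine expProd_le_expProd_weight hwp (fun j _ => ?_) hx
    have h1 : net.maxGain / net.pathRatio (2 * net.p) ≤ net.gain y j :=
      net.maxGain_div_pathRatio_le_gain hy
    have h2 : 0 < net.pathRatio (2 * net.p) := net.pathRatio_pos hp
    rw [le_div_iff₀ hg]
    calc q j n / net.pathRatio (2 * net.p) * net.gain y i
        ≤ q j n / net.pathRatio (2 * net.p) * net.maxGain :=
          mul_le_mul_of_nonneg_left hga (net.weight_nonneg hp hq j n)
      _ = net.maxGain / net.pathRatio (2 * net.p) * q j n := by ring
      _ ≤ net.gain y j * q j n := mul_le_mul_of_nonneg_right h1 (hq.1 j n)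

end Network

end

/-! ### Measurability, integrability and continuity of the rates. -/

noncomputable section

namespace Network

variable {B : ℕ} (net : Network B) {N K : ℕ}

theorem sumRate_eq (q : Fin B → Fin N → ℝ) (ω : Sample B N K) (u : Fin B → Fin N → Fin K) :
    net.sumRate q ω u = ∑ i, ∑ n,
      Real.log (1 + q i n * net.sinr (fun j => q j n) i (userView n ω (u i n))) := by
  simp only [sumRate, snr_mul_div_eq]

theorem measurable_sumRate (q : Fin B → Fin N → ℝ) (u : Fin B → Fin N → Fin K) :
    Measurable fun ω => net.sumRate q ω u := by
  simp only [sumRate_eq]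
  refine Finset.measurable_sum _ fun i _ => Finset.measurable_sum _ fun n _ => ?_
  have h := (net.measurable_sinr (fun j => q j n) i).comp
    (net.measurePreserving_userView_apply n (u i n)).measurable
  exact Real.measurable_log.comp (measurable_const.add (measurable_const.mul h))

theorem sumRate_le_maxRate (q : Fin B → Fin N → ℝ) (ω : Sample B N K)
    (u : Fin B → Fin N → Fin K) : net.sumRate q ω u ≤ net.maxRate q ω :=
  le_ciSup (f := fun u => net.sumRate q ω u) (Set.finite_range _).bddAbove u

theorem measurable_maxRate (q : Fin B → Fin N → ℝ) :
    Measurable fun ω : Sample B N K => net.maxRate q ω :=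
  Measurable.iSup fun u => net.measurable_sumRate q u

theorem log_rate_nonneg {q : Fin B → Fin N → ℝ} (hq : q ∈ net.powerSet N) (i : Fin B) (n : Fin N)
    (v : EuclideanSpace ℝ (Fin 2) × (Fin B → ℂ)) :
    0 ≤ Real.log (1 + q i n * net.sinr (fun j => q j n) i v) :=
  Real.log_nonneg (le_add_of_nonneg_right
    (mul_nonneg (hq.1 i n) (net.sinr_nonneg (fun j => hq.1 j n) i v)))

theorem sumRate_nonneg {q : Fin B → Fin N → ℝ} (hq : q ∈ net.powerSet N) (ω : Sample B N K)
    (u : Fin B → Fin N → Fin K) : 0 ≤ net.sumRate q ω u := by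
  rw [sumRate_eq]
  exact Finset.sum_nonneg fun i _ => Finset.sum_nonneg fun n _ => net.log_rate_nonneg hq i n _

theorem maxRate_nonneg {q : Fin B → Fin N → ℝ} (hq : q ∈ net.powerSet N) (ω : Sample B N K) :
    0 ≤ net.maxRate q ω :=
  Real.iSup_nonneg fun u => net.sumRate_nonneg hq ω u

/-- An integrable bound for the rates, uniform in the powers. -/
def rateBound (ω : Sample B N K) : ℝ :=
  ∑ i, ∑ n, ∑ k, net.Pcon * (net.maxGain * ‖ω.2 (i, k, n)‖ ^ 2)

theorem integrable_rateBound : Integrable (net.rateBound (N := N) (K := K)) (net.law N K) := by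
  refine integrable_finsetSum _ fun i _ => integrable_finsetSum _ fun n _ =>
    integrable_finsetSum _ fun k _ => (Integrable.const_mul ?_ _).const_mul _
  have hmp : MeasurePreserving (fun ω : Sample B N K => ω.2 (i, k, n)) (net.law N K)
      complexGaussian :=
    (measurePreserving_eval (fun _ => complexGaussian) (i, k, n)).comp measurePreserving_snd
  exact hmp.integrable_comp_of_integrable integrable_norm_sq_complexGaussian

theorem maxRate_le_rateBound {q : Fin B → Fin N → ℝ} (hq : q ∈ net.powerSet N)
    (ω : Sample B N K) : net.maxRate q ω ≤ net.rateBound ω := by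
  have hP := net.Pcon_pos
  have ha := net.maxGain_pos
  refine Real.iSup_le (fun u => ?_) (Finset.sum_nonneg fun i _ => Finset.sum_nonneg fun n _ =>
    Finset.sum_nonneg fun k _ => by positivity)
  rw [sumRate_eq]
  refine Finset.sum_le_sum fun i _ => Finset.sum_le_sum fun n _ => ?_
  have h0 := net.sinr_nonneg (fun j => hq.1 j n) i (userView n ω (u i n))
  have h1 := mul_nonneg (hq.1 i n) h0
  have h2 := Real.log_le_sub_one_of_pos
    (show 0 < 1 + q i n * net.sinr (fun j => q j n) i (userView n ω (u i n)) by linarith)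
  refine (h2.trans_eq (add_sub_cancel_left _ _)).trans ?_
  refine (mul_le_mul (le_Pcon_of_mem_powerSet hq i n) (net.sinr_le (fun j => hq.1 j n) i _)
    h0 hP.le).trans ?_
  exact Finset.single_le_sum
    (f := fun k => net.Pcon * (net.maxGain * ‖ω.2 (i, k, n)‖ ^ 2))
    (fun k _ => by positivity) (Finset.mem_univ (u i n))

theorem norm_maxRate_le {q : Fin B → Fin N → ℝ} (hq : q ∈ net.powerSet N) (ω : Sample B N K) :
    ‖net.maxRate q ω‖ ≤ net.rateBound ω := by
  rw [Real.norm_of_nonneg (net.maxRate_nonneg hq ω)]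
  exact net.maxRate_le_rateBound hq ω

theorem integrable_maxRate {q : Fin B → Fin N → ℝ} (hq : q ∈ net.powerSet N) :
    Integrable (fun ω => net.maxRate q ω) (net.law N K) :=
  net.integrable_rateBound.mono' (net.measurable_maxRate q).aestronglyMeasurable
    (ae_of_all _ fun ω => net.norm_maxRate_le hq ω)

theorem continuousOn_sumRate (ω : Sample B N K) (u : Fin B → Fin N → Fin K) :
    ContinuousOn (fun q => net.sumRate q ω u) (net.powerSet N) := by
  simp only [sumRate_eq]
  refine continuousOn_finsetSum _ fun i _ => continuousOn_finsetSum _ fun n _ => ?_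
  refine ContinuousOn.log ?_ fun q hq => ?_
  · refine continuousOn_const.add (ContinuousOn.mul (by fun_prop) ?_)
    simp only [sinr]
    refine ContinuousOn.div (by fun_prop) (by fun_prop) fun q hq => ?_
    refine (add_pos_of_pos_of_nonneg one_pos (Finset.sum_nonneg fun j _ => ?_)).ne'
    exact mul_nonneg (mul_nonneg (net.gain_pos _ _).le (hq.1 j n)) (sq_nonneg _)
  · have := mul_nonneg (hq.1 i n) (net.sinr_nonneg (fun j => hq.1 j n) i (userView n ω (u i n)))
    positivity

theorem continuousOn_maxRate (hK : 0 < K) (ω : Sample B N K) :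
    ContinuousOn (fun q => net.maxRate q ω) (net.powerSet N) := by
  have : Nonempty (Fin K) := ⟨⟨0, hK⟩⟩
  simp only [maxRate, ← Finset.sup'_univ_eq_ciSup]
  exact ContinuousOn.finset_sup'_apply _ fun u _ => net.continuousOn_sumRate ω u

/-- Dominated convergence, with `rateBound` dominating for all feasible powers at once; compactness
of `powerSet` then makes the maximum attained. -/
theorem continuousOn_expRate (hK : 0 < K) :
    ContinuousOn (net.expRate N K) (net.powerSet N) :=
  continuousOn_of_dominated (fun q _ => (net.measurable_maxRate q).aestronglyMeasurable)
    (fun _ hq => ae_of_all _ fun ω => net.norm_maxRate_le hq ω) net.integrable_rateBound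
    (ae_of_all _ fun ω => net.continuousOn_maxRate hK ω)

theorem isGreatest_CLB (hK : 0 < K) :
    IsGreatest (net.expRate N K '' net.powerSet N) (net.CLB N K) :=
  (net.isCompact_powerSet.image_of_continuousOn (net.continuousOn_expRate hK)).isGreatest_sSup
    (Nonempty.image _ ⟨0, net.zero_mem_powerSet⟩)

theorem expRate_le_CLB (hK : 0 < K) {q : Fin B → Fin N → ℝ} (hq : q ∈ net.powerSet N) :
    net.expRate N K q ≤ net.CLB N K :=
  (net.isGreatest_CLB hK).2 (mem_image_of_mem _ hq)

theorem CLB_nonneg (hK : 0 < K) : 0 ≤ net.CLB N K :=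
  (integral_nonneg fun ω => net.maxRate_nonneg net.zero_mem_powerSet ω).trans
    (net.expRate_le_CLB hK net.zero_mem_powerSet)

/-! ### The lower bound on `C*_LB`. -/

section LowerBound

variable {q : Fin B → Fin N → ℝ} {h x : ℝ} {i : Fin B} {n : Fin N}

/-- The event that some user has signal-to-interference ratio at least `x`. -/
def goodEvent (K : ℕ) (q : Fin B → Fin N → ℝ) (i : Fin B) (n : Fin N) (x : ℝ) :
    Set (Sample B N K) :=
  {ω | ∃ k, x ≤ net.sinr (fun j => q j n) i (userView n ω k)}

theorem measurableSet_goodEvent : MeasurableSet (net.goodEvent K q i n x) := by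
  simp only [goodEvent, ofPred_exists]
  refine MeasurableSet.iUnion fun k => measurableSet_le measurable_const ?_
  exact (net.measurable_sinr _ i).comp (net.measurePreserving_userView_apply n k).measurable

/-- On one resource block the users are i.i.d. and each succeeds with probability at least `1/h`, so
all fail with probability at most `(1 - 1/h)^K ≤ e^{-K/h}` when `h ≥ 1`; the exponential bound holds
for every `h > 0`. -/
theorem one_sub_exp_le_goodEvent (hh : 0 < h) (hx : 0 ≤ x) (hq : q ∈ net.powerSet N)
    (hqx : net.Constraint net.r₀ h q i n x) :
    1 - Real.exp (-(K / h)) ≤ (net.law N K).real (net.goodEvent K q i n x) := by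
  set S := {v | x ≤ net.sinr (fun j => q j n) i v} with hSdef
  have hS : MeasurableSet S := measurableSet_le measurable_const (net.measurable_sinr _ i)
  have hp : h⁻¹ ≤ net.userMeasure.real S :=
    (ENNReal.ofReal_le_iff_le_toReal (measure_ne_top _ _)).1
      (net.le_userMeasure_sinr_ge hh hx hq hqx)
  have hcompl : (net.law N K).real (net.goodEvent K q i n x)ᶜ = net.userMeasure.real Sᶜ ^ K := by
    have hset : (net.goodEvent K q i n x)ᶜ = userView n ⁻¹' pi univ fun _ => Sᶜ := by
      ext ω
      simp [goodEvent, hSdef]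
    rw [hset, measureReal_def, (net.measurePreserving_userView n).measure_preimage
      (MeasurableSet.univ_pi fun _ => hS.compl).nullMeasurableSet, Measure.pi_pi]
    simp [measureReal_def]
  rw [probReal_compl_eq_one_sub net.measurableSet_goodEvent, probReal_compl_eq_one_sub hS] at hcompl
  have h1 : 1 - net.userMeasure.real S ≤ Real.exp (-h⁻¹) :=
    (sub_le_sub_left hp 1).trans (Real.one_sub_le_exp_neg _)
  have h2 : (1 - net.userMeasure.real S) ^ K ≤ Real.exp (-(K / h)) := by
    refine (pow_le_pow_left₀ (sub_nonneg.2 measureReal_le_one) h1 K).trans_eq ?_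
    rw [← Real.exp_nat_mul]
    congr 1
    ring
  linarith

theorem sum_indicator_le_maxRate (hK : 0 < K) (hq : q ∈ net.powerSet N)
    {x : Fin B → Fin N → ℝ} (hx : ∀ i n, 0 ≤ x i n) (ω : Sample B N K) :
    ∑ i, ∑ n, (net.goodEvent K q i n (x i n)).indicator
      (fun _ => Real.log (1 + q i n * x i n)) ω ≤ net.maxRate q ω := by
  -- Each pair `(i, n)` chooses its user separately: a successful one if it exists, and user `0`
  -- otherwise, whose rate is still nonnegative.
  have hex : ∀ i n, ∃ k, ω ∈ net.goodEvent K q i n (x i n) →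
      x i n ≤ net.sinr (fun j => q j n) i (userView n ω k) := by
    intro i n
    by_cases hω : ω ∈ net.goodEvent K q i n (x i n)
    · obtain ⟨k, hk⟩ := hω
      exact ⟨k, fun _ => hk⟩
    · exact ⟨⟨0, hK⟩, fun h => absurd h hω⟩
  choose u hu using hex
  refine le_trans ?_ (net.sumRate_le_maxRate q ω u)
  rw [sumRate_eq]
  refine Finset.sum_le_sum fun i _ => Finset.sum_le_sum fun n _ => ?_
  by_cases hω : ω ∈ net.goodEvent K q i n (x i n)
  · rw [indicator_of_mem hω]
    have h0 := hq.1 i n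
    have := mul_nonneg h0 (hx i n)
    refine Real.log_le_log (by linarith) ?_
    have := hu i n hω
    gcongr
  · rw [indicator_of_notMem hω]
    exact net.log_rate_nonneg hq i n _

theorem mul_opObj_le_expRate (hK : 0 < K) (hh : 0 < h) (hq : q ∈ net.powerSet N)
    {x : Fin B → Fin N → ℝ} (hx : ∀ i n, 0 ≤ x i n)
    (hqx : ∀ i n, net.Constraint net.r₀ h q i n (x i n)) :
    (1 - Real.exp (-(K / h))) * opObj q x ≤ net.expRate N K q := by
  have hint : ∀ i n, Integrable ((net.goodEvent K q i n (x i n)).indicator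
      (fun _ => Real.log (1 + q i n * x i n))) (net.law N K) := fun i n =>
    (integrable_const _).indicator net.measurableSet_goodEvent
  calc (1 - Real.exp (-(K / h))) * opObj q x
      = ∑ i, ∑ n, (1 - Real.exp (-(K / h))) * Real.log (1 + q i n * x i n) := by
        simp only [opObj, Finset.mul_sum]
    _ ≤ ∑ i, ∑ n, (net.law N K).real (net.goodEvent K q i n (x i n)) *
          Real.log (1 + q i n * x i n) := by
        refine Finset.sum_le_sum fun i _ => Finset.sum_le_sum fun n _ =>
          mul_le_mul_of_nonneg_right (net.one_sub_exp_le_goodEvent hh (hx i n) hq (hqx i n))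
            (Real.log_nonneg ?_)
        have := mul_nonneg (hq.1 i n) (hx i n)
        linarith
    _ = ∫ ω, ∑ i, ∑ n, (net.goodEvent K q i n (x i n)).indicator
          (fun _ => Real.log (1 + q i n * x i n)) ω ∂(net.law N K) := by
        rw [integral_finsetSum _ fun i _ => integrable_finsetSum _ fun n _ => hint i n]
        refine Finset.sum_congr rfl fun i _ => ?_
        rw [integral_finsetSum _ fun n _ => hint i n]
        refine Finset.sum_congr rfl fun n _ => ?_
        rw [integral_indicator_const _ net.measurableSet_goodEvent, smul_eq_mul]
    _ ≤ net.expRate N K q := integral_mono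
        (integrable_finsetSum _ fun i _ => integrable_finsetSum _ fun n _ => hint i n)
        (net.integrable_maxRate hq) fun ω => net.sum_indicator_le_maxRate hK hq hx ω

theorem lower_bound (hK : 0 < K) {S : ℝ} (hS : 0 < S) :
    (1 - Real.exp (-S)) * net.OP N net.r₀ (K / S) ≤ net.CLB N K := by
  have hK' : (0 : ℝ) < K := Nat.cast_pos.2 hK
  have hh : 0 < K / S := div_pos hK' hS
  -- Below the threshold `OP` vanishes and the bound reduces to `0 ≤ C*_LB`.
  rcases le_or_gt (net.p ^ 2 / net.r₀ ^ 2) (K / S) with hle | hlt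
  · obtain ⟨q, hq, x, hx, hqx, hOP⟩ := net.exists_OP_eq (N := N) net.r₀_pos hle
    have := net.mul_opObj_le_expRate hK hh hq hx hqx
    rw [div_div_cancel₀ hK'.ne'] at this
    rw [hOP]
    exact this.trans (net.expRate_le_CLB hK hq)
  · rw [net.OP_eq_zero net.r₀_pos hh hlt, mul_zero]
    exact net.CLB_nonneg hK

end LowerBound

/-! ### The upper bound on `C*_LB`. -/

section UpperBound

variable {q : Fin B → Fin N → ℝ} {h : ℝ}

theorem integrable_excess {x : ℝ} (hx : 0 ≤ x) (hq : q ∈ net.powerSet N)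
    {i : Fin B} {n : Fin N} (hqx : net.Constraint (2 * net.p) h q i n x) (k : Fin K) :
    Integrable (fun ω => max (net.sinr (fun j => q j n) i (userView n ω k) - x) 0)
      (net.law N K) := by
  refine (net.measurePreserving_userView_apply n k).integrable_comp_of_integrable
    (g := fun v => max (net.sinr (fun j => q j n) i v - x) 0) ⟨?_, ?_⟩
  · have := net.measurable_sinr (fun j => q j n) i
    exact Measurable.aestronglyMeasurable (by fun_prop)
  · rw [hasFiniteIntegral_iff_ofReal (ae_of_all _ fun v =>
      le_max_right (net.sinr (fun j => q j n) i v - x) 0)]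
    simp only [ENNReal.ofReal_max, ENNReal.ofReal_zero, max_eq_left zero_le]
    exact (net.lintegral_sinr_excess_le hx hq hqx).trans_lt ENNReal.ofReal_lt_top

theorem integral_excess_le (hh : 0 < h) {x : ℝ} (hx : 0 ≤ x) (hq : q ∈ net.powerSet N)
    {i : Fin B} {n : Fin N} (hqx : net.Constraint (2 * net.p) h q i n x) (k : Fin K) :
    ∫ ω, max (net.sinr (fun j => q j n) i (userView n ω k) - x) 0 ∂(net.law N K) ≤
      net.maxGain * (net.r₀ ^ 2 * h / net.p ^ 2)⁻¹ := by
  have hr := net.r₀_pos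
  have hp := net.p_pos
  have ha := net.maxGain_pos
  have hm := net.measurable_sinr (fun j => q j n) i
  have hmp := net.measurePreserving_userView_apply (N := N) (K := K) n k
  rw [integral_eq_lintegral_of_nonneg_ae (ae_of_all _ fun ω => le_max_right
    (net.sinr (fun j => q j n) i (userView n ω k) - x) 0) (net.integrable_excess hx hq hqx k).1]
  refine ENNReal.toReal_le_of_le_ofReal (by positivity) ?_
  simp only [ENNReal.ofReal_max, ENNReal.ofReal_zero, max_eq_left zero_le]
  rw [hmp.lintegral_comp (f := fun v => ENNReal.ofReal (net.sinr (fun j => q j n) i v - x))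
    (by fun_prop)]
  exact net.lintegral_sinr_excess_le hx hq hqx

/-- The slope of `s ↦ log (1 + w s)` at `x` is `w / (1 + w x) ≤ 1/x ≤ 1/l`, for every `w ≥ 0`;
concavity extends the bound beyond `x`. -/
theorem log_one_add_mul_le_excess {w x s l : ℝ} (hw : 0 ≤ w) (hl : 0 < l) (hlx : l ≤ x)
    (hs : 0 ≤ s) :
    Real.log (1 + w * s) ≤ Real.log (1 + w * x) + l⁻¹ * max (s - x) 0 := by
  have hx : 0 < x := hl.trans_le hlx
  have hm : 0 ≤ max (s - x) 0 := le_max_right _ _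
  have h1 : Real.log (1 + w * s) ≤ Real.log (1 + w * x + w * max (s - x) 0) := by
    refine Real.log_le_log (by positivity) ?_
    have := mul_le_mul_of_nonneg_left (le_max_left (s - x) 0) hw
    linarith
  have h2 := log_one_add_add_le (mul_nonneg hw hx.le) (mul_nonneg hw hm)
  have h3 : w * max (s - x) 0 / (1 + w * x) ≤ l⁻¹ * max (s - x) 0 := by
    rw [mul_div_right_comm]
    refine mul_le_mul_of_nonneg_right ?_ hm
    rw [div_le_iff₀ (by positivity), inv_mul_eq_div, le_div_iff₀ hl]
    nlinarith [mul_le_mul_of_nonneg_left hlx hw]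
  linarith

/-- The excess of the selected user is bounded by the sum over all users, which removes the maximum
over allocations. Each mean excess is of order `1/K`, so the sum over `K` users stays bounded. -/
theorem expRate_le (hK : 0 < K) (hq : q ∈ net.powerSet N)
    {x : Fin B → Fin N → ℝ} (hqx : ∀ i n, net.Constraint (2 * net.p) K q i n (x i n))
    {l : ℝ} (hl : 0 < l) (hlx : ∀ i n, l ≤ x i n) :
    net.expRate N K q ≤
      opObj q x + B * N * (net.maxGain * (net.p ^ 2 / net.r₀ ^ 2)) / l := by
  have hr := net.r₀_pos
  have hp := net.p_pos
  have hK' : (0 : ℝ) < K := Nat.cast_pos.2 hK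
  have hx : ∀ i n, 0 ≤ x i n := fun i n => hl.le.trans (hlx i n)
  have hint : ∀ i n (k : Fin K), Integrable (fun ω =>
      max (net.sinr (fun j => q j n) i (userView n ω k) - x i n) 0) (net.law N K) :=
    fun i n k => net.integrable_excess (hx i n) hq (hqx i n) k
  have hint2 : ∀ i n, Integrable (fun ω => Real.log (1 + q i n * x i n) +
      l⁻¹ * ∑ k : Fin K, max (net.sinr (fun j => q j n) i (userView n ω k) - x i n) 0)
      (net.law N K) := fun i n =>
    (integrable_const _).add ((integrable_finsetSum _ fun k _ => hint i n k).const_mul _)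
  calc net.expRate N K q
      ≤ ∫ ω, ∑ i, ∑ n, (Real.log (1 + q i n * x i n) + l⁻¹ * ∑ k,
          max (net.sinr (fun j => q j n) i (userView n ω k) - x i n) 0) ∂(net.law N K) := by
        refine integral_mono (net.integrable_maxRate hq)
          (integrable_finsetSum _ fun i _ => integrable_finsetSum _ fun n _ => hint2 i n)
          fun ω => ?_
        have : Nonempty (Fin K) := ⟨⟨0, hK⟩⟩
        refine ciSup_le fun u => ?_
        rw [sumRate_eq]
        refine Finset.sum_le_sum fun i _ => Finset.sum_le_sum fun n _ => ?_
        refine (log_one_add_mul_le_excess (hq.1 i n) hl (hlx i n)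
          (net.sinr_nonneg (fun j => hq.1 j n) i _)).trans ?_
        gcongr
        exact Finset.single_le_sum (f := fun k =>
          max (net.sinr (fun j => q j n) i (userView n ω k) - x i n) 0)
          (fun k _ => le_max_right _ _) (Finset.mem_univ (u i n))
    _ = ∑ i, ∑ n, (Real.log (1 + q i n * x i n) + l⁻¹ * ∑ k : Fin K,
          ∫ ω, max (net.sinr (fun j => q j n) i (userView n ω k) - x i n) 0 ∂(net.law N K)) := by
        rw [integral_finsetSum _ fun i _ => integrable_finsetSum _ fun n _ => hint2 i n]
        refine Finset.sum_congr rfl fun i _ => ?_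
        rw [integral_finsetSum _ fun n _ => hint2 i n]
        refine Finset.sum_congr rfl fun n _ => ?_
        rw [integral_add (integrable_const _)
          ((integrable_finsetSum _ fun k _ => hint i n k).const_mul _), integral_const_mul,
          integral_finsetSum _ fun k _ => hint i n k]
        simp
    _ ≤ ∑ i, ∑ n, (Real.log (1 + q i n * x i n) +
          l⁻¹ * (net.maxGain * (net.p ^ 2 / net.r₀ ^ 2))) := by
        refine Finset.sum_le_sum fun i _ => Finset.sum_le_sum fun n _ => ?_
        gcongr
        refine (Finset.sum_le_sum fun k _ =>
          net.integral_excess_le hK' (hx i n) hq (hqx i n) k).trans_eq ?_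
        rw [Finset.sum_const, Finset.card_univ, Fintype.card_fin, nsmul_eq_mul]
        field_simp
    _ = _ := by
        simp only [Finset.sum_add_distrib, opObj, Finset.sum_const, Finset.card_univ,
          Fintype.card_fin, nsmul_eq_mul]
        ring

theorem CLB_le (hK : 0 < K) (hh : net.p ^ 2 / net.r₀ ^ 2 ≤ K)
    (hl : 0 < net.lHat (2 * net.p) K) :
    net.CLB N K ≤ net.OP N (2 * net.p) K +
      B * N * (net.maxGain * (net.p ^ 2 / net.r₀ ^ 2)) / net.lHat (2 * net.p) K := by
  have hp : 0 < 2 * net.p := by linarith [net.p_pos]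
  obtain ⟨q, hq, hqC⟩ := (net.isGreatest_CLB (N := N) hK).1
  obtain ⟨x, hx, hqx⟩ := net.exists_solution hp hh hq
  rw [← hqC]
  refine (net.expRate_le hK hq hqx hl fun i n =>
    net.lHat_le_of_constraint hp hh hq (hx i n) (hqx i n)).trans ?_
  gcongr
  exact net.opObj_le_OP hp (Nat.cast_pos.2 hK) hq hx hqx

theorem upper_bound (hB : 0 < B) (hN : 0 < N) {lbar : ℕ → ℝ}
    (hlbar : Asymptotics.IsEquivalent atTop lbar (fun K : ℕ => net.lHat (2 * net.p) K)) :
    ∀ᶠ K : ℕ in atTop, net.CLB N K ≤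
      (1 + net.maxGain * Real.eulerMascheroniConstant / lbar K) * net.OP N (2 * net.p) K := by
  have hp : 0 < 2 * net.p := by linarith [net.p_pos]
  have ha := net.maxGain_pos
  set u := Real.eulerMascheroniConstant
  have hu0 : 0 < u := by linarith [Real.one_half_lt_eulerMascheroniConstant]
  have hl : Tendsto (fun K : ℕ => net.lHat (2 * net.p) K) atTop atTop :=
    (net.tendsto_lHat_atTop hp).comp tendsto_natCast_atTop_atTop
  have hOP : Tendsto (fun K : ℕ => net.OP N (2 * net.p) K) atTop atTop :=
    (net.tendsto_OP_atTop ⟨0, hB⟩ ⟨0, hN⟩ hp).comp tendsto_natCast_atTop_atTop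
  set C := B * N * (net.maxGain * (net.p ^ 2 / net.r₀ ^ 2))
  have hle : ∀ᶠ K : ℕ in atTop,
      ‖lbar K - net.lHat (2 * net.p) K‖ ≤ 1 / 2 * ‖net.lHat (2 * net.p) K‖ :=
    hlbar.isLittleO.bound (by norm_num)
  -- The lower bound on `OP` is chosen so that `maxGain * u * OP ≥ 2 C`; the `2` pays for replacing
  -- `lHat` by `lbar`, since eventually `lbar ≤ 2 * lHat`.
  filter_upwards [eventually_gt_atTop 0, hl.eventually_gt_atTop 0,
    tendsto_natCast_atTop_atTop.eventually (eventually_ge_atTop (net.p ^ 2 / net.r₀ ^ 2)),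
    hOP.eventually_ge_atTop (2 * C / (net.maxGain * u)), hle]
    with K hK hl0 hKh hOPK hleK
  refine (net.CLB_le hK hKh hl0).trans ?_
  rw [Real.norm_eq_abs, Real.norm_eq_abs, abs_of_pos hl0, abs_le] at hleK
  have hlb0 : 0 < lbar K := by linarith
  have hlb2 : lbar K ≤ 2 * net.lHat (2 * net.p) K := by linarith
  have h1 : C / net.lHat (2 * net.p) K ≤ 2 * C / lbar K := by
    have hC0 : 0 ≤ C := by
      have := net.threshold_pos
      positivity
    rw [div_le_div_iff₀ hl0 hlb0]
    nlinarith
  have h2 : 2 * C / lbar K ≤ net.maxGain * u / lbar K * net.OP N (2 * net.p) K := by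
    rw [div_le_iff₀ (by positivity)] at hOPK
    rw [div_mul_eq_mul_div, mul_comm (net.maxGain * u)]
    exact div_le_div_of_nonneg_right hOPK hlb0.le
  linarith

end UpperBound

end Network

end

theorem theorem3 {B N : ℕ} (hB : 0 < B) (hN : 0 < N) (net : Network B) :
    -- `C*_LB` and `OP` are well defined, and their maxima are attained
    (∀ K : ℕ, 1 ≤ K →
      (∀ q ∈ net.powerSet N, Integrable (fun ω => net.maxRate q ω) (net.law N K)) ∧
      IsGreatest (net.expRate N K '' net.powerSet N) (net.CLB N K)) ∧
    (∀ c h : ℝ, 0 < c → 0 < h → IsGreatest (net.opValues N c h) (net.OP N c h)) ∧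
    (∀ c h : ℝ, 0 < c → net.p ^ 2 / net.r₀ ^ 2 ≤ h → ∀ q ∈ net.powerSet N, ∀ i n,
      ∃! x : ℝ, 0 ≤ x ∧ net.Constraint c h q i n x) ∧
    -- lower bound
    (∀ᶠ K : ℕ in atTop, ∀ S₁ ∈ Ioc (0 : ℝ) K,
      (1 - Real.exp (-S₁)) * net.OP N net.r₀ (K / S₁) ≤ net.CLB N K) ∧
    -- `l̂` is well defined, increasing and unbounded in its second argument
    (∀ η₁ : ℝ, 0 < η₁ →
      (∀ η₂ : ℝ, net.p ^ 2 / net.r₀ ^ 2 ≤ η₂ → ∀ l : ℝ,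
        (0 ≤ l ∧ net.LEquation η₁ η₂ l) ↔ l = net.lHat η₁ η₂) ∧
      StrictMonoOn (net.lHat η₁) (Ici (net.p ^ 2 / net.r₀ ^ 2)) ∧
      Tendsto (net.lHat η₁) atTop atTop) ∧
    -- upper bound, in particular for `lbar K = l̂(2p, K)`
    (∀ lbar : ℕ → ℝ,
      Asymptotics.IsEquivalent atTop lbar (fun K : ℕ => net.lHat (2 * net.p) K) →
      ∀ᶠ K : ℕ in atTop,
        net.CLB N K ≤
          (1 + net.β ^ 2 * net.r₀ ^ (-(2 * net.α)) * Real.eulerMascheroniConstant / lbar K) *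
            net.OP N (2 * net.p) K) ∧
    -- monotonicity in `c`
    (∀ c₁ c₂ h : ℝ, 0 < c₁ → c₁ ≤ c₂ → net.p ^ 2 / net.r₀ ^ 2 < h →
      0 < net.OP N c₁ h ∧
      1 ≤ net.OP N c₂ h / net.OP N c₁ h ∧
      net.OP N c₂ h / net.OP N c₁ h ≤ (c₂ / c₁) ^ (2 * net.α)) := by

  have hp : 0 < 2 * net.p := by linarith [net.p_pos]
  refine ⟨fun K hK => ⟨fun q hq => net.integrable_maxRate hq, net.isGreatest_CLB hK⟩,
    fun c h hc hh => net.isGreatest_OP hc hh,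
    fun c h hc hh q hq i n => net.existsUnique_constraint hc hh hq i n,
    (eventually_gt_atTop 0).mono fun K hK S hS => net.lower_bound hK hS.1,
    fun η hη => ⟨fun h hh l => net.lEquation_iff_eq_lHat hη hh l, net.strictMonoOn_lHat hη,
      net.tendsto_lHat_atTop hη⟩,
    fun lbar hlbar => net.upper_bound hB hN hlbar, fun c₁ c₂ h hc hcc hh => ?_⟩
  have hpos := net.OP_pos ⟨0, hB⟩ ⟨0, hN⟩ hc hh
  exact ⟨hpos, (one_le_div hpos).2 (net.OP_mono_left hc hcc hh.le),
    (div_le_iff₀ hpos).2 (net.OP_le_mul_OP hc hcc hh.le)⟩
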